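/- Let $A$ be a finite-dimensional real unital alternative $*$-algebra, $1\neq 0$, with involution $x\mapsto x^c$; put $t(x)=x+x^c$, $n(x)=xx^c$, $\mathbb S_A=\{J: t(J)=0,\ n(J)=1\}$, and assume $\mathbb S_A\neq\emptyset$. Let $Q_A=\mathbb R\cup\{x: t(x)\in\mathbb R,\ n(x)\in\mathbb R,\ t(x)^2<4n(x)\}=\bigcup_{J\in\mathbb S_A}\mathbb C_J$ be the quadratic cone, where $\mathbb C_J=\mathbb R+\mathbb R J$, and assume that $A$ has a norm with $\|x\|^2=n(x)$ on $Q_A$. A subset of $Q_A$ is circular if it has the form $\Omega_D=\{\alpha+\beta J: \alpha+i\beta\in D,\ J\in\mathbb S_A\}$ with $D\subseteq\mathbb C$, which can be taken invariant under conjugation; $\mathbb S_y$ is the smallest circular set containing $y$. Let $A_{\mathbb C}=A+\imath A$ be the complexification of $A$, with $(x+\imath y)^c=x^c+\imath y^c$. A function $f=\mathcal I(F)$ on $\Omega_D\neq\emptyset$ is a slice function if $f(\alpha+\beta J)=F_1(\alpha+i\beta)+JF_2(\alpha+i\beta)$ for a (unique) stem function $F=F_1+\imath F_2:D\to A_{\mathbb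 C}$, that is, one with $F(\bar z)=F_1(z)-\imath F_2(z)$; it is slice preserving if $F_1,F_2$ are real-valued, and slice regular if $\Omega_D$ is open in $Q_A$, $F$ is $C^1$ and $\partial F/\partial\bar z=0$. Put $\mathcal I(F)\cdot\mathcal I(G)=\mathcal I(FG)$, $\mathcal I(F)^c=\mathcal I(F^c)$, $N(f)=f\cdot f^c$. A slice function $f$ is tame if $N(f)$ is slice preserving and $N(f)=N(f^c)$. For $y\in Q_A$ let $\Delta_y(x)=x^2-x\,t(y)+n(y)$, $\mathrm u(x,y)=\|\Delta_y(x)\|^{1/2}$, $\mathrm U(y,r)=\{x\in Q_A:\mathrm u(x,y)<r\}$ and $\mathrm U(y,0,r)=\{x\in Q_A: 0<\mathrm u(x,y)<r\}$. Let $\Sigma(y,0,R)$ be the set of those $x\in Q_A$ with $0<|x-y|<R$ if $x,y$ lie in a common plane $\mathbb C_J$, and with $|\mathrm{Re}\,x-\mathrm{Re}\,y|^2+(|\mathrm{Im}\,x|-|\mathrm{Im}\,y|)^2>0$ and $|\mathrm{Re}\,x-\mathrm{Re}\,y|^2+(|\mathrm{Im}\,x|+|\mathrm{Im}\,y|)^2<R^2$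 otherwise. The point $y$ is a singularity of a slice regular $f$ on $\Omega'$ if $\Sigma(y,0,R)\subseteq\Omega'$ for some $R>0$. Then, for small radii, $f$ has a Laurent expansion $\sum_{n\in\mathbb Z}(x-y)^{\bullet n}\cdot a_n$ in $\Sigma(y,0,R)$ and a spherical Laurent expansion $\sum_{n\in\mathbb Z}\mathscr S_{y,n}\cdot c_n$ in $\mathrm U(y,0,r)$, where powers $^{\bullet n}$ are taken with respect to the slice product, $\mathscr S_{y,2k}=\Delta_y^k$ and $\mathscr S_{y,2k+1}=\Delta_y^k\cdot(x-y)$. The order $\mathrm{ord}_f(y)\in\mathbb N\cup\{\infty\}$ is the least $m$ with $a_n=0$ for all $n<-m$; the spherical order $\mathrm{ord}_f(\mathbb S_y)$ is the least even $m$ with $c_n=0$ for all $n<-m$. The singularity $y$ is a pole if $\mathrm{ord}_f(y)<\infty$, and removable if $f$ extends to a slice regular function on a circular open set containing $y$. If $\Omega$ is a nonempty circular open subset of $Q_A$, then $f$ is semiregular in $\Omega$ if it is slice regular on a circular open $\Omega'\subseteq\Omega$ and every point of $\Omega\setminus\Omega'$ is a pole or a removable singularity of $f$; it is tame in $\Omega$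 if it is tame on $\Omega'$. For $y\in\Omega\setminus\mathbb R$, the spherical multiplicity of a semiregular function $h$ at $\mathbb S_y$ is $\max\{0,2m\}$ if $h=\Delta_y^m g$ in some $\mathrm U(y,0,r)$ with $m\in\mathbb Z$ and $g$ slice regular on $\mathrm U(y,r)$, $g\not\equiv0$ in $\mathbb S_y$; for $y\in\Omega\cap\mathbb R$, the classical multiplicity of $h$ at $y$ is $\max\{0,n\}$ if $h=(x-y)^n g$ in some $\mathrm U(y,0,r)$ with $n\in\mathbb Z$ and $g$ slice regular on $\mathrm U(y,r)$, $g(y)\neq0$. Both are $\infty$ if $h\equiv0$ in some $\mathrm U(y,0,r)$. **Theorem.** Let $f$ be semiregular and tame in the circular open set $\Omega=\Omega_D$, slice regular on $\Omega'$ as above, and suppose that $N(f)\not\equiv0$; if $\Omega$ is not a single slice domain or product domain (that is, if $D$ is neither connected nor a pair of connected components exchanged by conjugation), suppose that $N(f)$ is not identically zero on any of the slice domains and product domains of which $\Omega$ is the disjoint union. Put $\Omega''=\{x\in\Omega': N(f)(x)\neq0\}$. Then: 1. $f^{-\bullet}(x):=N(f)(x)^{-1}f^c(x)$ is a slice function on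 $\Omega''$ with $f\cdot f^{-\bullet}=1=f^{-\bullet}\cdot f$; 2. $f^{-\bullet}$ is semiregular in $\Omega$: it is slice regular on $\Omega''$, and every point of $\Omega\setminus\Omega''$ is a pole or a removable singularity of it; 3. $f^{-\bullet}$ is tame in $\Omega$; 4. for every $y\in\Omega\setminus\mathbb R$, $\mathrm{ord}_{f^{-\bullet}}(\mathbb S_y)$ is at most the spherical multiplicity of $N(f)$ at $\mathbb S_y$ plus $\mathrm{ord}_f(\mathbb S_y)$; for every $y\in\Omega\cap\mathbb R$, $\mathrm{ord}_{f^{-\bullet}}(y)$ is at most the classical multiplicity of $N(f)$ at $y$ plus $\mathrm{ord}_f(y)$. In particular, where $f$ is slice regular (or has removable singularities), these orders are bounded by the multiplicities of $N(f)$. -/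

import Mathlib

/-! Slice regular and semiregular functions over a real alternative `*`-algebra. -/

noncomputable section

open scoped Classical

/-- A real unital `*`-algebra, not assumed associative, whose underlying real vector space carries
a norm. No compatibility between the norm and the product is asked for here. -/
class NormedStarAlg (A : Type*) extends NormedAddCommGroup A, NonAssocRing A, StarRing A,
    NormedSpace ℝ A where
  smul_mul_assoc' : ∀ (r : ℝ) (x y : A), (r • x) * y = r • (x * y)
  mul_smul_comm' : ∀ (r : ℝ) (x y : A), x * (r • y) = r • (x * y)
  star_smul' : ∀ (r : ℝ) (x : A), star (r • x) = r • star x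

namespace SliceReg

section Algebra

variable (A : Type*) [NormedStarAlg A]

/-- The sphere `𝕊_A` of imaginary units: `t(J) = 0` and `n(J) = 1`. -/
def imagUnits : Set A := {J | J + star J = 0 ∧ J * star J = 1}

/-- The quadratic cone `Q_A`. -/
def quadCone : Set A :=
  {x | (∃ r : ℝ, x = r • (1 : A)) ∨
    ∃ t n : ℝ, x + star x = t • (1 : A) ∧ x * star x = n • (1 : A) ∧ t ^ 2 < 4 * n}

/-- The standing assumptions on `A`: it is a nonzero alternative algebra of finite dimension, there
is an imaginary unit, and `‖x‖² = n(x)` for all `x` in the quadratic cone. -/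
class IsSliceAlg : Prop where
  one_ne_zero : (1 : A) ≠ 0
  left_alternative : ∀ x y : A, (x * x) * y = x * (x * y)
  right_alternative : ∀ x y : A, (y * x) * x = y * (x * x)
  finiteDimensional : FiniteDimensional ℝ A
  imagUnits_nonempty : (imagUnits A).Nonempty
  norm_sq : ∀ x ∈ quadCone A, x * star x = (‖x‖ ^ 2) • (1 : A)

end Algebra

section Coordinates

variable {A : Type*} [NormedStarAlg A]

/-- `α + β J`, for `z = α + i β`. -/
def pt (J : A) (z : ℂ) : A := z.re • (1 : A) + z.im • J

/-- The plane `ℂ_J`. -/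
def slice (J : A) : Set A := Set.range (pt J)

/-- The real part `t(x)/2`, as an element of `A`. -/
def reA (x : A) : A := (1 / 2 : ℝ) • (x + star x)

/-- The imaginary part `x - t(x)/2`. -/
def imA (x : A) : A := (1 / 2 : ℝ) • (x - star x)

/-- The real part as a real number (it is one whenever `x ∈ Q_A`). -/
def reR (x : A) : ℝ := if h : ∃ r : ℝ, reA x = r • (1 : A) then h.choose else 0

/-- The point `z = α + i β`, `β ≥ 0`, such that `x = α + β J` for some imaginary unit `J`. -/
def coord (x : A) : ℂ := ⟨reR x, ‖imA x‖⟩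

/-- The unit `J` in `x = α + β J`, `β > 0`; it is `0` when `x` is real. -/
def unitIm (x : A) : A := ‖imA x‖⁻¹ • imA x

/-- The circularization `Ω_E` of a set `E` of complex numbers. -/
def circ (E : Set ℂ) : Set A := {x | ∃ z ∈ E, ∃ J ∈ imagUnits A, x = pt J z}

/-- The sphere `𝕊_y`. -/
def sphere (y : A) : Set A := circ {coord y}

/-- The conjugation-invariant set `D` with `Ω = Ω_D`, for a circular set `Ω`. -/
def sliceDom (Ω : Set A) : Set ℂ := {z | ∃ J ∈ imagUnits A, pt J z ∈ Ω}

/-- `Ω` is circular and open in the quadratic cone. -/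
def IsCircularOpen (Ω : Set A) : Prop :=
  (∃ E : Set ℂ, Ω = circ E) ∧ ∃ U : Set A, IsOpen U ∧ Ω = U ∩ quadCone A

/-- The inverse `n(x)⁻¹ x^c` of a nonzero element `x` of the quadratic cone. -/
def coneInv (x : A) : A := (‖x‖ ^ 2)⁻¹ • star x

end Coordinates

section Complexification

/-! The complexified algebra `A_ℂ = A + ι A`; its elements `x + ι y` are written as pairs. -/

variable {A : Type*} [NormedStarAlg A]

/-- The product of `A_ℂ`. -/
def cmul (p q : A × A) : A × A := (p.1 * q.1 - p.2 * q.2, p.1 * q.2 + p.2 * q.1)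

/-- The involution `(x + ι y)^c = x^c + ι y^c`. -/
def cstar (p : A × A) : A × A := (star p.1, star p.2)

/-- The complex conjugation `x + ι y ↦ x - ι y`. -/
def cconj (p : A × A) : A × A := (p.1, -p.2)

/-- The action on `A_ℂ` of its central subalgebra `ℝ + ι ℝ ≃ ℂ`. -/
def csmul (c : ℂ) (p : A × A) : A × A :=
  (c.re • p.1 - c.im • p.2, c.re • p.2 + c.im • p.1)

/-- Powers in `A_ℂ`. -/
def cpow (p : A × A) : ℕ → A × A
  | 0 => (1, 0)
  | n + 1 => cmul p (cpow p n)

end Complexification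

section SliceFunctions

variable {A : Type*} [NormedStarAlg A]

/-! Functions on a subset `Ω` of `Q_A` are given by total functions `A → A`; only their values on
`Ω` matter. Likewise for stem functions. -/

/-- `F` is a stem function on `D`. -/
def IsStem (D : Set ℂ) (F : ℂ → A × A) : Prop :=
  ∀ z ∈ D, F (starRingEnd ℂ z) = cconj (F z)

/-- `f = I(F)` on `Ω`: `f(α + β J) = F₁(α + i β) + J F₂(α + i β)`. -/
def Induces (Ω : Set A) (F : ℂ → A × A) (f : A → A) : Prop :=
  ∀ z ∈ sliceDom Ω, ∀ J ∈ imagUnits A, f (pt J z) = (F z).1 + J * (F z).2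

/-- `f` is a slice function on the circular set `Ω`. -/
def IsSlice (Ω : Set A) (f : A → A) : Prop :=
  Ω.Nonempty ∧ (∃ E : Set ℂ, Ω = circ E) ∧
    ∃ F : ℂ → A × A, IsStem (sliceDom Ω) F ∧ Induces Ω F f

/-- The function `I(F)` induced by `F`. -/
def ind (F : ℂ → A × A) (x : A) : A := (F (coord x)).1 + unitIm x * (F (coord x)).2

variable (A) in
/-- Some imaginary unit. -/
def someUnit : A := Classical.epsilon (fun J : A => J ∈ imagUnits A)

/-- The stem function of a slice function, recovered from its values on one plane `ℂ_J`. The result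
does not depend on `J`, see `stem_eq` below. -/
def stem (f : A → A) (z : ℂ) : A × A :=
  ((1 / 2 : ℝ) • (f (pt (someUnit A) z) + f (pt (someUnit A) (starRingEnd ℂ z))),
    -((1 / 2 : ℝ) •
      (someUnit A * (f (pt (someUnit A) z) - f (pt (someUnit A) (starRingEnd ℂ z))))))

/-- The slice product `f · g = I(F G)`. -/
def sliceMul (f g : A → A) : A → A := ind (fun z => cmul (stem f z) (stem g z))

/-- The conjugate function `f^c = I(F^c)`. -/
def sliceConj (f : A → A) : A → A := ind (fun z => cstar (stem f z))

/-- The normal function `N(f) = f · f^c`. -/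
def normalFn (f : A → A) : A → A := sliceMul f (sliceConj f)

/-- `f` is slice preserving on `Ω`: it is induced by a stem function with real components. -/
def IsSlicePreserving (Ω : Set A) (f : A → A) : Prop :=
  Ω.Nonempty ∧ (∃ E : Set ℂ, Ω = circ E) ∧
    ∃ F : ℂ → A × A, IsStem (sliceDom Ω) F ∧ Induces Ω F f ∧
      ∀ z ∈ sliceDom Ω, ∃ a b : ℝ, F z = (a • (1 : A), b • (1 : A))

/-- A slice function `f` on `Ω` is tame if `N(f)` is slice preserving and equals `N(f^c)`. -/
def IsTame (Ω : Set A) (f : A → A) : Prop :=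
  IsSlice Ω f ∧ IsSlicePreserving Ω (normalFn f) ∧
    ∀ x ∈ Ω, normalFn f x = normalFn (sliceConj f) x

/-- `∂F/∂z̄ = (∂F/∂α + ι ∂F/∂β) / 2`. -/
def dbar (F : ℂ → A × A) (z : ℂ) : A × A :=
  (1 / 2 : ℝ) • (fderiv ℝ F z 1 + csmul Complex.I (fderiv ℝ F z Complex.I))

/-- `f ∈ SR(Ω)`: `Ω` is nonempty, circular and open in `Q_A`, and `f` is induced by a `C¹` stem
function `F` with `∂F/∂z̄ = 0`. -/
def IsSliceRegular (Ω : Set A) (f : A → A) : Prop :=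
  Ω.Nonempty ∧ IsCircularOpen Ω ∧
    ∃ F : ℂ → A × A, IsStem (sliceDom Ω) F ∧ Induces Ω F f ∧
      ContDiffOn ℝ 1 F (sliceDom Ω) ∧ ∀ z ∈ sliceDom Ω, dbar F z = 0

/-- The function `x ↦ N(f)(x)⁻¹ f^c(x)`. -/
def sliceInv (f : A → A) (x : A) : A := coneInv (normalFn f x) * sliceConj f x

end SliceFunctions

section Singularities

variable {A : Type*} [NormedStarAlg A]

/-- `x` and `y` lie in the same plane `ℂ_J`. -/
def SameSlice (x y : A) : Prop := ∃ J ∈ imagUnits A, x ∈ slice J ∧ y ∈ slice J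

/-- The function `σ_A`. -/
def sigmaDist (x y : A) : ℝ :=
  if SameSlice x y then ‖x - y‖
  else Real.sqrt (‖reA x - reA y‖ ^ 2 + (‖imA x‖ + ‖imA y‖) ^ 2)

/-- The function `τ_A`. -/
def tauDist (x y : A) : ℝ :=
  if SameSlice x y then ‖x - y‖
  else Real.sqrt (‖reA x - reA y‖ ^ 2 + (‖imA x‖ - ‖imA y‖) ^ 2)

/-- The set `Σ(y, R₁, R₂)`. -/
def sigmaShell (y : A) (R₁ R₂ : ℝ) : Set A :=
  {x ∈ quadCone A | R₁ < tauDist x y ∧ sigmaDist x y < R₂}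

/-- The Cassini pseudodistance `u(x, y) = ‖Δ_y(x)‖^{1/2}`, `Δ_y(x) = x² - x t(y) + n(y)`. -/
def cassini (x y : A) : ℝ := Real.sqrt ‖x * x - x * (y + star y) + y * star y‖

/-- The Cassini ball `U(y, r)`. -/
def cassiniBall (y : A) (r : ℝ) : Set A := {x ∈ quadCone A | cassini x y < r}

/-- The Cassini shell `U(y, r₁, r₂)`. -/
def cassiniShell (y : A) (r₁ r₂ : ℝ) : Set A :=
  {x ∈ quadCone A | r₁ < cassini x y ∧ cassini x y < r₂}

/-- The stem function of `Δ_y`, with values in `ℝ + ι ℝ ≃ ℂ`. -/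
def deltaStem (y : A) (z : ℂ) : ℂ := z ^ 2 - z * ((2 * reR y : ℝ) : ℂ) + ((‖y‖ ^ 2 : ℝ) : ℂ)

/-- The stem function of `x ↦ x - y`. -/
def binomStem (y : A) (z : ℂ) : A × A := (z.re • (1 : A) - y, z.im • (1 : A))

/-- The stem function of the slice inverse `(x - y)^{-•} = Δ_y(x)⁻¹ (x - y^c)`. -/
def binomInvStem (y : A) (z : ℂ) : A × A := csmul (deltaStem y z)⁻¹ (binomStem (star y) z)

/-- The stem function of `(x - y)^{• n}`. -/
def binomZPowStem (y : A) (n : ℤ) (z : ℂ) : A × A :=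
  match n with
  | Int.ofNat k => cpow (binomStem y z) k
  | Int.negSucc k => cpow (binomInvStem y z) (k + 1)

/-- The term `(x - y)^{• n} · a` of a Laurent series. -/
def laurentTerm (y : A) (n : ℤ) (a : A) : A → A :=
  ind (fun z => cmul (binomZPowStem y n z) (a, 0))

/-- The term `S_{y,n} · c` of a spherical Laurent series, where `S_{y,2k} = Δ_y^k` and
`S_{y,2k+1} = Δ_y^k · (x - y)`. -/
def sphericalTerm (y : A) (n : ℤ) (c : A) : A → A :=
  ind (fun z => csmul (deltaStem y z ^ (n / 2))
    (if Even n then (c, 0) else cmul (binomStem y z) (c, 0)))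

/-- `y` is a singularity for a slice regular function on `Ω`. -/
def IsSingularity (Ω : Set A) (y : A) : Prop :=
  y ∈ quadCone A ∧ ∃ R : ℝ, 0 < R ∧ sigmaShell y 0 R ⊆ Ω

/-- `∑ₙ (x - y)^{• n} · aₙ` is the Laurent expansion at `y` of the function `f` on `Ω`. -/
def IsLaurentExpansion (Ω : Set A) (f : A → A) (y : A) (a : ℤ → A) : Prop :=
  ∃ R : ℝ, 0 < R ∧ sigmaShell y 0 R ⊆ Ω ∧
    ∀ x ∈ sigmaShell y 0 R, HasSum (fun n : ℤ => laurentTerm y n (a n) x) (f x)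

/-- The order `ord_f(y)`. -/
def ord (Ω : Set A) (f : A → A) (y : A) : ℕ∞ :=
  sInf {m | ∃ k : ℕ, m = (k : ℕ∞) ∧
    ∃ a : ℤ → A, IsLaurentExpansion Ω f y a ∧ ∀ n : ℤ, n < -(k : ℤ) → a n = 0}

/-- `y` is a pole for the function `f` on `Ω`. -/
def IsPole (Ω : Set A) (f : A → A) (y : A) : Prop := IsSingularity Ω y ∧ ord Ω f y < ⊤

/-- `y` is a removable singularity for the function `f` on `Ω`. -/
def IsRemovable (Ω : Set A) (f : A → A) (y : A) : Prop :=
  IsSingularity Ω y ∧ ∃ (Ω₁ : Set A) (g : A → A),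
    Ω ⊆ Ω₁ ∧ y ∈ Ω₁ ∧ IsSliceRegular Ω₁ g ∧ ∀ x ∈ Ω, g x = f x

/-- `∑ₙ S_{y,n} · cₙ` is the spherical Laurent expansion at `y` of the function `f` on `Ω`. -/
def IsSphericalExpansion (Ω : Set A) (f : A → A) (y : A) (c : ℤ → A) : Prop :=
  ∃ r : ℝ, 0 < r ∧ cassiniShell y 0 r ⊆ Ω ∧
    ∀ x ∈ cassiniShell y 0 r, HasSum (fun n : ℤ => sphericalTerm y n (c n) x) (f x)

/-- The spherical order `ord_f(𝕊_y)`. -/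
def sphericalOrd (Ω : Set A) (f : A → A) (y : A) : ℕ∞ :=
  sInf {m | ∃ k : ℕ, m = ((2 * k : ℕ) : ℕ∞) ∧
    ∃ c : ℤ → A, IsSphericalExpansion Ω f y c ∧ ∀ n : ℤ, n < -((2 * k : ℕ) : ℤ) → c n = 0}

/-- `f = Δ_y^m g` near `𝕊_y` (off `𝕊_y`), with `g` slice regular near `𝕊_y` and not identically
zero in `𝕊_y`. -/
def HasSphericalFactor (Ω : Set A) (f : A → A) (y : A) (m : ℤ) : Prop :=
  ∃ r : ℝ, 0 < r ∧ cassiniShell y 0 r ⊆ Ω ∧ ∃ g : A → A,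
    IsSliceRegular (cassiniBall y r) g ∧ (∃ w ∈ sphere y, g w ≠ 0) ∧
      ∀ x ∈ cassiniShell y 0 r, f x = ind (fun z => csmul (deltaStem y z ^ m) (stem g z)) x

/-- The spherical multiplicity of `f` at `𝕊_y`, `y` not real: it is `2m` if `f = Δ_y^m g` as above
with `m ≥ 0`, it is `0` if `m < 0`, and it is `∞` if `f` vanishes identically near `𝕊_y`. -/
def sphericalMult (Ω : Set A) (f : A → A) (y : A) : ℕ∞ :=
  sInf {k | ∃ m : ℤ, HasSphericalFactor Ω f y m ∧ k = ((2 * m.toNat : ℕ) : ℕ∞)}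

/-- For real `y`: `f = (x - y)^n h` near `y` (off `y`), with `h` slice regular near `y` and
`h(y) ≠ 0`. -/
def HasRealFactor (Ω : Set A) (f : A → A) (y : A) (n : ℤ) : Prop :=
  ∃ r : ℝ, 0 < r ∧ cassiniShell y 0 r ⊆ Ω ∧ ∃ h : A → A,
    IsSliceRegular (cassiniBall y r) h ∧ h y ≠ 0 ∧
      ∀ x ∈ cassiniShell y 0 r,
        f x = ind (fun z => csmul ((z - ((reR y : ℝ) : ℂ)) ^ n) (stem h z)) x

/-- The classical multiplicity of `f` at the real point `y`: it is `n` if `f = (x - y)^n h` as above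
with `n ≥ 0`, it is `0` if `n < 0`, and it is `∞` if `f` vanishes identically near `y`. -/
def classicalMult (Ω : Set A) (f : A → A) (y : A) : ℕ∞ :=
  sInf {k | ∃ n : ℤ, HasRealFactor Ω f y n ∧ k = ((n.toNat : ℕ) : ℕ∞)}

/-- `f`, defined and slice regular on `Ω'`, is semiregular in `Ω`. -/
def IsSemiregular (Ω Ω' : Set A) (f : A → A) : Prop :=
  Ω.Nonempty ∧ IsCircularOpen Ω ∧ Ω' ⊆ Ω ∧ IsSliceRegular Ω' f ∧
    ∀ y ∈ Ω \ Ω', IsPole Ω' f y ∨ IsRemovable Ω' f y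

/-- `h`, defined on `Ω' ⊆ Ω`, vanishes identically on none of the slice domains and product domains
of which `Ω` is the disjoint union. If `Ω` is itself a slice domain or a product domain, this says
that `h` is not identically zero. -/
def NowhereIdenticallyZero (Ω Ω' : Set A) (h : A → A) : Prop :=
  ∀ z ∈ sliceDom Ω, ∃ x ∈ Ω' ∩ circ (connectedComponentIn (sliceDom Ω) z), h x ≠ 0

end Singularities

section Checks

variable {A : Type*} [NormedStarAlg A]

theorem smul_mul_A (r : ℝ) (x y : A) : (r • x) * y = r • (x * y) :=
  NormedStarAlg.smul_mul_assoc' r x y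

theorem mul_smul_A (r : ℝ) (x y : A) : x * (r • y) = r • (x * y) :=
  NormedStarAlg.mul_smul_comm' r x y

theorem star_smul_A (r : ℝ) (x : A) : star (r • x) = r • star x :=
  NormedStarAlg.star_smul' r x

theorem star_one_A : star (1 : A) = 1 := by
  have h : star (star (1 : A) * 1) = star (star (1 : A)) := by rw [mul_one]
  rw [star_mul, star_star, mul_one] at h
  exact h

theorem star_unit {J : A} (hJ : J ∈ imagUnits A) : star J = -J :=
  (neg_eq_of_add_eq_zero_right hJ.1).symm

theorem unit_sq {J : A} (hJ : J ∈ imagUnits A) : J * J = -1 := by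
  have h := hJ.2
  rw [star_unit hJ, mul_neg] at h
  rw [← h, neg_neg]

theorem star_pt {J : A} (hJ : J ∈ imagUnits A) (z : ℂ) :
    star (pt J z) = pt J (starRingEnd ℂ z) := by
  simp only [pt, star_add, star_smul_A, star_one_A, star_unit hJ, Complex.conj_re, Complex.conj_im,
    smul_neg, neg_smul]

theorem imA_pt {J : A} (hJ : J ∈ imagUnits A) (z : ℂ) : imA (pt J z) = z.im • J := by
  rw [imA, star_pt hJ]
  simp only [pt, Complex.conj_re, Complex.conj_im]
  module

theorem reA_pt {J : A} (hJ : J ∈ imagUnits A) (z : ℂ) : reA (pt J z) = z.re • (1 : A) := by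
  rw [reA, star_pt hJ]
  simp only [pt, Complex.conj_re, Complex.conj_im]
  module

variable [IsSliceAlg A]

theorem someUnit_mem : someUnit A ∈ imagUnits A :=
  Classical.epsilon_spec (p := fun J : A => J ∈ imagUnits A) IsSliceAlg.imagUnits_nonempty

theorem unit_mul_unit_mul {J : A} (hJ : J ∈ imagUnits A) (x : A) : J * (J * x) = -x := by
  rw [← IsSliceAlg.left_alternative, unit_sq hJ, neg_mul, one_mul]

theorem norm_unit {J : A} (hJ : J ∈ imagUnits A) : ‖J‖ = 1 := by
  have hq : J ∈ quadCone A :=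
    Or.inr ⟨0, 1, by simpa using hJ.1, by simpa using hJ.2, by norm_num⟩
  have h := IsSliceAlg.norm_sq J hq
  rw [hJ.2] at h
  have h' : (‖J‖ ^ 2 - 1) • (1 : A) = 0 := by rw [sub_smul, ← h, one_smul, sub_self]
  rcases smul_eq_zero.1 h' with h0 | h0
  · nlinarith [norm_nonneg J]
  · exact absurd h0 IsSliceAlg.one_ne_zero

theorem reR_pt {J : A} (hJ : J ∈ imagUnits A) (z : ℂ) : reR (pt J z) = z.re := by
  have h : ∃ r : ℝ, reA (pt J z) = r • (1 : A) := ⟨z.re, reA_pt hJ z⟩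
  rw [reR, dif_pos h]
  have h1 : z.re • (1 : A) = h.choose • (1 : A) := (reA_pt hJ z).symm.trans h.choose_spec
  exact (smul_left_injective ℝ (IsSliceAlg.one_ne_zero (A := A)) h1).symm

theorem coord_pt {J : A} (hJ : J ∈ imagUnits A) (z : ℂ) : coord (pt J z) = ⟨z.re, |z.im|⟩ := by
  rw [coord, reR_pt hJ, imA_pt hJ, norm_smul, norm_unit hJ, mul_one, Real.norm_eq_abs]

/-- A slice function is induced by exactly one stem function, namely by `stem f`. -/
theorem stem_eq {Ω : Set A} {F : ℂ → A × A} {f : A → A} (hF : IsStem (sliceDom Ω) F)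
    (hΩ : ∀ z ∈ sliceDom Ω, starRingEnd ℂ z ∈ sliceDom Ω) (hf : Induces Ω F f) {z : ℂ}
    (hz : z ∈ sliceDom Ω) : stem f z = F z := by
  have hJ := someUnit_mem (A := A)
  have h1 := hf z hz _ hJ
  have h2 := hf _ (hΩ z hz) _ hJ
  rw [hF z hz] at h2
  simp only [cconj, mul_neg] at h2
  ext
  · simp only [stem, h1, h2]
    module
  · have e : (F z).1 + someUnit A * (F z).2 - ((F z).1 + -(someUnit A * (F z).2)) =
        (2 : ℝ) • (someUnit A * (F z).2) := by module
    simp only [stem, h1, h2, e, mul_smul_A, unit_mul_unit_mul hJ]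
    module

/-- `ind F` is the function induced by the stem function `F`. -/
theorem induces_ind {Ω : Set A} {F : ℂ → A × A} (hF : IsStem (sliceDom Ω) F) :
    Induces Ω F (ind F) := by
  intro z hz J hJ
  rw [ind, coord_pt hJ, unitIm, imA_pt hJ, norm_smul, norm_unit hJ, mul_one, Real.norm_eq_abs]
  have hs := hF z hz
  rcases lt_trichotomy z.im 0 with h | h | h
  · have e : (⟨z.re, |z.im|⟩ : ℂ) = starRingEnd ℂ z := by
      apply Complex.ext <;> simp [abs_of_neg h]
    rw [e, hs, abs_of_neg h, smul_smul, inv_neg, neg_mul, inv_mul_cancel₀ h.ne]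
    simp [cconj]
  · have e : (⟨z.re, |z.im|⟩ : ℂ) = z := by apply Complex.ext <;> simp [h]
    have e2 : starRingEnd ℂ z = z := by apply Complex.ext <;> simp [h]
    rw [e2] at hs
    have h0 : (F z).2 = 0 := by
      have h3 : (F z).2 = -(F z).2 := congrArg Prod.snd hs
      have h4 : (2 : ℝ) • (F z).2 = 0 := by
        rw [two_smul]; nth_rewrite 1 [h3]; exact neg_add_cancel _
      simpa using h4
    rw [e, h0, mul_zero, mul_zero]
  · have e : (⟨z.re, |z.im|⟩ : ℂ) = z := by apply Complex.ext <;> simp [abs_of_pos h]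
    rw [e, abs_of_pos h, smul_smul, inv_mul_cancel₀ h.ne', one_smul]

end Checks

end SliceReg

end

/-! A slice function is determined by its stem function `F : D → A_ℂ`, so every assertion is moved
to the complex plane. A real basis of `A` identifies `A_ℂ` with some `ℂ^d` (`toCoord`); there slice
regularity is holomorphy of `F` (`dbar_eq_zero_iff`), the product is complex bilinear and the
involution is complex linear. Tameness gives `F F^c = F^c F = ν · 1` with a complex-valued function
`ν = normStem f`, so the stem function of `f^{-•}` is `ν⁻¹ F^c`. As `ν⁻¹` is a central scalar, the
inverse property and the tameness of `f^{-•}` follow from bilinearity, without associativity.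

For semiregularity, poles of `f` must become poles of `F`. Left alternativity makes left
multiplication by `ℂ_J` a complex structure on `A`, and `A_ℂ` splits into the two complex subspaces
on which `ι` acts as `J` and as `-J`. On the plane of `y` slice powers become ordinary powers, so
the Laurent expansions at `y` and at `y^c` each describe one half of `F` near the same point `z₀`,
and `F` is meromorphic there (`meromorphicAt_stemCoord`). Then `ν` is meromorphic, the identity
theorem on the components of `D` shows that it has no zeros in a punctured neighbourhood of any
point (`IsSemiregular.eventually_normStem_ne_zero`), and `ν⁻¹ F^c` is meromorphic. Conversely, a
meromorphic stem function yields a Laurent expansion with finite principal part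
(`exists_isLaurentExpansion`).

For the orders, a bound on the principal part is turned into analyticity of `(z - z₀)^k F` at `z₀`
for real points, and of `Δ_y^k F` at both `z₀` and `conj z₀` for spheres
(`exists_analyticAt_of_isSphericalExpansion`, `exists_isSphericalExpansion`). If `ν = δ^m q` with
`q` nonvanishing (`IsTame.exists_normStem_eq`) and `δ^k F = P` is analytic, then `δ^(max(m,0)+k) ν⁻¹
F^c = δ^(max(-m,0)) q⁻¹ P^c` is analytic too (`pow_smul_invCoord`). -/

set_option linter.unusedSectionVars false

noncomputable section

namespace SliceReg

open scoped ComplexConjugate Topology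

open Filter

/-! ### The planes `ℂ_J` and the quadratic cone. -/

section Planes

variable {A : Type*} [NormedStarAlg A]

theorem neg_mem_imagUnits {J : A} (hJ : J ∈ imagUnits A) : -J ∈ imagUnits A := by
  have h := hJ.1
  refine ⟨?_, ?_⟩
  · rw [star_neg, ← neg_add, h, neg_zero]
  · rw [star_neg, neg_mul_neg, hJ.2]

theorem pt_neg (J : A) (z : ℂ) : pt (-J) z = pt J (conj z) := by
  simp only [pt, Complex.conj_re, Complex.conj_im, smul_neg, neg_smul]

theorem pt_sub (J : A) (u v : ℂ) : pt J (u - v) = pt J u - pt J v := by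
  simp only [pt, Complex.sub_re, Complex.sub_im]
  module

theorem pt_ofReal (J : A) (r : ℝ) : pt J (r : ℂ) = r • (1 : A) := by
  simp [pt]

theorem pt_of_im_eq_zero (J : A) {z : ℂ} (hz : z.im = 0) : pt J z = z.re • (1 : A) := by
  simp [pt, hz]

theorem pt_one (J : A) : pt J 1 = 1 := by simp [pt]

theorem pt_zero (J : A) : pt J 0 = 0 := by simp [pt]

theorem pt_mul_apply (J : A) (u : ℂ) (x : A) : pt J u * x = u.re • x + u.im • (J * x) := by
  rw [pt, add_mul, smul_mul_A, smul_mul_A, one_mul]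

theorem continuous_pt (J : A) : Continuous (pt J) := by
  unfold pt
  fun_prop

theorem pt_add_star {J : A} (hJ : J ∈ imagUnits A) (z : ℂ) :
    pt J z + star (pt J z) = (2 * z.re) • (1 : A) := by
  rw [star_pt hJ]
  simp only [pt, Complex.conj_re, Complex.conj_im]
  module

variable [IsSliceAlg A]

/-- Left alternativity alone makes `A` a complex vector space, with `ℂ_J` acting by left
multiplication. -/
theorem pt_mul_mul {J : A} (hJ : J ∈ imagUnits A) (u v : ℂ) (x : A) :
    pt J u * (pt J v * x) = pt J (u * v) * x := by
  simp only [pt_mul_apply, mul_add, mul_smul_A, unit_mul_unit_mul hJ, Complex.mul_re,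
    Complex.mul_im]
  module

theorem pt_mul {J : A} (hJ : J ∈ imagUnits A) (u v : ℂ) :
    pt J u * pt J v = pt J (u * v) := by
  have h := pt_mul_mul hJ u v 1
  rwa [mul_one, mul_one] at h

theorem pt_mul_star {J : A} (hJ : J ∈ imagUnits A) (z : ℂ) :
    pt J z * star (pt J z) = (‖z‖ ^ 2) • (1 : A) := by
  rw [star_pt hJ, pt_mul hJ, Complex.mul_conj, pt_ofReal, Complex.normSq_eq_norm_sq]

theorem mem_quadCone_iff {x : A} :
    x ∈ quadCone A ↔ ∃ J ∈ imagUnits A, ∃ z : ℂ, x = pt J z := by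
  constructor
  · rintro (⟨r, rfl⟩ | ⟨t, n, ht, hn, hlt⟩)
    · exact ⟨_, someUnit_mem, r, (pt_ofReal _ r).symm⟩
    -- Completing the square: `x² = t x - n` gives `(x - t/2)² = -s²`, so `(x - t/2)/s` is an
    -- imaginary unit.
    · set s : ℝ := Real.sqrt (n - t ^ 2 / 4) with hs
      have hpos : 0 < n - t ^ 2 / 4 := by linarith
      have hs0 : 0 < s := Real.sqrt_pos.2 hpos
      have hs2 : s ^ 2 = n - t ^ 2 / 4 := Real.sq_sqrt hpos.le
      have hstar : star x = t • (1 : A) - x := eq_sub_of_add_eq' ht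
      have hxx : x * x = t • x - n • (1 : A) := by
        rw [hstar, mul_sub, mul_smul_A, mul_one] at hn
        rw [← hn]; abel
      refine ⟨s⁻¹ • (x - (t / 2) • (1 : A)), ⟨?_, ?_⟩, ⟨t / 2, s⟩, ?_⟩
      · rw [star_smul_A, star_sub, star_smul_A, star_one_A, hstar]
        module
      · have e : star (s⁻¹ • (x - (t / 2) • (1 : A))) = -(s⁻¹ • (x - (t / 2) • (1 : A))) := by
          rw [star_smul_A, star_sub, star_smul_A, star_one_A, hstar]
          module
        rw [e, mul_neg, smul_mul_A, mul_smul_A, sub_mul, mul_sub, mul_sub, smul_mul_A, mul_smul_A,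
          smul_mul_A, mul_smul_A, one_mul, mul_one, mul_one, hxx]
        have : -(s⁻¹ • s⁻¹ • (t • x - n • (1 : A) - (t / 2) • x -
            ((t / 2) • x - (t / 2) • (t / 2) • (1 : A)))) =
            (s⁻¹ * s⁻¹ * (n - t ^ 2 / 4)) • (1 : A) := by
          module
        rw [this, ← hs2]
        have : s⁻¹ * s⁻¹ * s ^ 2 = 1 := by field_simp
        rw [this, one_smul]
      · simp only [pt]
        rw [smul_smul, mul_inv_cancel₀ hs0.ne', one_smul]
        abel
  · rintro ⟨J, hJ, z, rfl⟩
    by_cases hz : z.im = 0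
    · exact Or.inl ⟨z.re, pt_of_im_eq_zero J hz⟩
    · refine Or.inr ⟨2 * z.re, ‖z‖ ^ 2, pt_add_star hJ z, pt_mul_star hJ z, ?_⟩
      rw [Complex.sq_norm, Complex.normSq_apply]
      nlinarith [sq_pos_of_ne_zero hz]

theorem pt_mem_quadCone {J : A} (hJ : J ∈ imagUnits A) (z : ℂ) : pt J z ∈ quadCone A :=
  mem_quadCone_iff.2 ⟨J, hJ, z, rfl⟩

theorem smul_one_injective {r s : ℝ} (h : r • (1 : A) = s • (1 : A)) : r = s :=
  smul_left_injective ℝ (IsSliceAlg.one_ne_zero (A := A)) h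

theorem norm_pt {J : A} (hJ : J ∈ imagUnits A) (z : ℂ) : ‖pt J z‖ = ‖z‖ := by
  have h := IsSliceAlg.norm_sq _ (pt_mem_quadCone hJ z)
  rw [pt_mul_star hJ] at h
  exact ((sq_eq_sq₀ (norm_nonneg _) (norm_nonneg _)).1 (smul_one_injective h)).symm

theorem pt_eq_zero_iff {J : A} (hJ : J ∈ imagUnits A) {z : ℂ} : pt J z = 0 ↔ z = 0 := by
  rw [← norm_eq_zero, norm_pt hJ, norm_eq_zero]

theorem coneInv_pt {J : A} (hJ : J ∈ imagUnits A) (z : ℂ) : coneInv (pt J z) = pt J z⁻¹ := by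
  rw [coneInv, norm_pt hJ, star_pt hJ]
  simp only [pt, Complex.inv_re, Complex.inv_im, Complex.conj_re, Complex.conj_im, smul_add,
    smul_smul, Complex.sq_norm]
  congr 2 <;> ring

theorem coord_pt_eq_or {J : A} (hJ : J ∈ imagUnits A) (z : ℂ) :
    coord (pt J z) = z ∨ coord (pt J z) = conj z := by
  rw [coord_pt hJ]
  rcases abs_choice z.im with h | h
  · left; apply Complex.ext <;> simp [h]
  · right; apply Complex.ext <;> simp [h]

theorem coord_im_nonneg (y : A) : 0 ≤ (coord y).im := norm_nonneg _

theorem imA_pt_norm {J : A} (hJ : J ∈ imagUnits A) (z : ℂ) : ‖imA (pt J z)‖ = |z.im| := by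
  rw [imA_pt hJ, norm_smul, norm_unit hJ, mul_one, Real.norm_eq_abs]

theorem unitIm_pt {J : A} (hJ : J ∈ imagUnits A) {z : ℂ} (hz : 0 < z.im) :
    unitIm (pt J z) = J := by
  rw [unitIm, imA_pt_norm hJ, imA_pt hJ, abs_of_pos hz, smul_smul, inv_mul_cancel₀ hz.ne',
    one_smul]

/-- Every point of the quadratic cone is `α + β J` with `α + i β` its coordinate. -/
theorem exists_eq_pt_coord {x : A} (hx : x ∈ quadCone A) :
    ∃ J ∈ imagUnits A, x = pt J (coord x) := by
  obtain ⟨J, hJ, z, rfl⟩ := mem_quadCone_iff.1 hx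
  rcases coord_pt_eq_or hJ z with h | h
  · exact ⟨J, hJ, by rw [h]⟩
  · exact ⟨-J, neg_mem_imagUnits hJ, by rw [h, pt_neg, Complex.conj_conj]⟩

theorem coord_im_eq_zero_iff {y : A} (hy : y ∈ quadCone A) :
    (coord y).im = 0 ↔ y ∈ Set.range (fun r : ℝ => r • (1 : A)) := by
  obtain ⟨J, hJ, h⟩ := exists_eq_pt_coord hy
  constructor
  · intro h0
    rw [pt_of_im_eq_zero J h0] at h
    exact ⟨(coord y).re, h.symm⟩
  · rintro ⟨r, rfl⟩
    simp only
    rw [← pt_ofReal (someUnit A) r, coord_pt someUnit_mem]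
    simp

end Planes

/-! ### The algebra `A_ℂ` and its splitting along `J` and `-J`. -/

section Complexified

variable {A : Type*} [NormedStarAlg A]

/-- The value at `J` of the map `A_ℂ → A` sending `p + ι q` to `p + J q`. -/
def ev (J : A) (p : A × A) : A := p.1 + J * p.2

/-- The embedding `x ↦ (x - ι J x) / 2` of `A`, with the complex structure given by `J`, in `A_ℂ`. -/
def eps (J x : A) : A × A := ((1 / 2 : ℝ) • x, -((1 / 2 : ℝ) • (J * x)))

theorem csmul_one (p : A × A) : csmul 1 p = p := by simp [csmul]

theorem csmul_csmul (u v : ℂ) (p : A × A) : csmul u (csmul v p) = csmul (u * v) p := by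
  ext <;> simp only [csmul, Complex.mul_re, Complex.mul_im] <;> module

theorem cmul_csmul (u : ℂ) (p q : A × A) : cmul p (csmul u q) = csmul u (cmul p q) := by
  ext <;> simp only [csmul, cmul, mul_sub, mul_add, mul_smul_A] <;> module

theorem csmul_cmul (u : ℂ) (p q : A × A) : cmul (csmul u p) q = csmul u (cmul p q) := by
  ext <;> simp only [csmul, cmul, sub_mul, add_mul, smul_mul_A] <;> module

theorem cstar_csmul (u : ℂ) (p : A × A) : cstar (csmul u p) = csmul u (cstar p) := by
  ext <;> simp only [csmul, cstar, star_sub, star_add, star_smul_A]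

theorem cstar_cstar (p : A × A) : cstar (cstar p) = p := by
  ext <;> simp [cstar]

theorem cconj_csmul (u : ℂ) (p : A × A) : cconj (csmul u p) = csmul (conj u) (cconj p) := by
  ext <;> simp only [csmul, cconj, Complex.conj_re, Complex.conj_im] <;> module

theorem cconj_cmul (p q : A × A) : cconj (cmul p q) = cmul (cconj p) (cconj q) := by
  ext <;> simp only [cmul, cconj, neg_mul, mul_neg, neg_neg, neg_add_rev]
  abel

theorem cconj_cstar (p : A × A) : cconj (cstar p) = cstar (cconj p) := by
  ext <;> simp [cstar, cconj]

theorem cmul_add (p q r : A × A) : cmul p (q + r) = cmul p q + cmul p r := by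
  ext <;> simp only [cmul, mul_add, Prod.fst_add, Prod.snd_add] <;> abel

theorem add_cmul (p q r : A × A) : cmul (p + q) r = cmul p r + cmul q r := by
  ext <;> simp only [cmul, add_mul, Prod.fst_add, Prod.snd_add] <;> abel

theorem csmul_one_eq (u : ℂ) : csmul u ((1 : A), (0 : A)) = (u.re • (1 : A), u.im • (1 : A)) := by
  ext <;> simp [csmul]

theorem ev_csmul_one (J : A) (u : ℂ) : ev J (csmul u ((1 : A), (0 : A))) = pt J u := by
  rw [csmul_one_eq, ev, mul_smul_A, mul_one, pt]

variable [IsSliceAlg A]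

theorem ev_csmul {J : A} (hJ : J ∈ imagUnits A) (u : ℂ) (p : A × A) :
    ev J (csmul u p) = pt J u * ev J p := by
  simp only [ev, csmul, pt_mul_apply, mul_add, mul_smul_A, unit_mul_unit_mul hJ]
  module

theorem eps_pt_mul {J : A} (hJ : J ∈ imagUnits A) (u : ℂ) (x : A) :
    eps J (pt J u * x) = csmul u (eps J x) := by
  ext <;> simp only [eps, csmul, pt_mul_apply, mul_add, mul_smul_A, unit_mul_unit_mul hJ] <;>
    module

/-- `eps J ∘ ev J` is the projection of `A_ℂ` onto the subspace where `ι` acts as left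
multiplication by `J`; the projections for `J` and `-J` are complementary. Thus a stem function is
recovered from the values at `α + βJ` and `α - βJ`, each contributing one half. -/
theorem eps_ev_add {J : A} (hJ : J ∈ imagUnits A) (p : A × A) :
    eps J (ev J p) + eps (-J) (ev (-J) p) = p := by
  ext <;> simp only [eps, ev, Prod.fst_add, Prod.snd_add, mul_add, neg_mul, mul_neg,
    unit_mul_unit_mul hJ] <;> module

/-- On pairs of elements of `ℂ_J`, the map `ev J` is multiplicative. -/
theorem ev_cmul_pt {J : A} (hJ : J ∈ imagUnits A) (u v : ℂ) (q : A × A) :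
    ev J (cmul (pt J u, pt J v) q) = pt J (u + Complex.I * v) * ev J q := by
  simp only [ev, cmul, pt_mul_apply, mul_add, mul_smul_A, unit_mul_unit_mul hJ,
    Complex.add_re, Complex.add_im, Complex.mul_re, Complex.mul_im, Complex.I_re, Complex.I_im]
  module

end Complexified

/-! ### Circular sets and their conjugation-invariant plane domains. -/

section CircularSets

variable {A : Type*} [NormedStarAlg A] [IsSliceAlg A]

theorem pt_eq_pt {J J' : A} (hJ : J ∈ imagUnits A) (hJ' : J' ∈ imagUnits A) {z w : ℂ}
    (h : pt J z = pt J' w) : w = z ∨ w = conj z := by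
  have h1 := coord_pt hJ z
  rw [h, coord_pt hJ'] at h1
  obtain ⟨hre, him⟩ := Complex.ext_iff.1 h1
  simp only at hre him
  rcases abs_eq_abs.1 him with h2 | h2
  · left; exact Complex.ext hre h2
  · right; exact Complex.ext (by simpa using hre) (by simpa using h2)

theorem pt_mem_circ_iff {J : A} (hJ : J ∈ imagUnits A) {E : Set ℂ} {z : ℂ} :
    pt J z ∈ circ (A := A) E ↔ z ∈ E ∨ conj z ∈ E := by
  constructor
  · rintro ⟨w, hw, J', hJ', h⟩
    rcases pt_eq_pt hJ hJ' h with rfl | rfl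
    · exact Or.inl hw
    · exact Or.inr hw
  · rintro (h | h)
    · exact ⟨z, h, J, hJ, rfl⟩
    · exact ⟨_, h, -J, neg_mem_imagUnits hJ, by rw [pt_neg, Complex.conj_conj]⟩

theorem mem_sliceDom_circ {E : Set ℂ} {z : ℂ} :
    z ∈ sliceDom (circ (A := A) E) ↔ z ∈ E ∨ conj z ∈ E :=
  ⟨fun ⟨_, hJ, h⟩ => (pt_mem_circ_iff hJ).1 h,
    fun h => ⟨_, someUnit_mem, (pt_mem_circ_iff someUnit_mem).2 h⟩⟩

theorem sliceDom_circ {E : Set ℂ} (hE : ∀ z ∈ E, conj z ∈ E) : sliceDom (circ (A := A) E) = E := by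
  ext z
  rw [mem_sliceDom_circ]
  refine ⟨?_, Or.inl⟩
  rintro (h | h)
  · exact h
  · simpa using hE _ h

/-- `Ω` is circular. -/
abbrev IsCircular (Ω : Set A) : Prop := ∃ E : Set ℂ, Ω = circ E

theorem IsCircular.pt_mem_iff {Ω : Set A} (h : IsCircular Ω) {J : A} (hJ : J ∈ imagUnits A)
    {z : ℂ} : pt J z ∈ Ω ↔ z ∈ sliceDom Ω := by
  obtain ⟨E, rfl⟩ := h
  rw [pt_mem_circ_iff hJ, mem_sliceDom_circ]

theorem IsCircular.conj_mem {Ω : Set A} (h : IsCircular Ω) {z : ℂ} (hz : z ∈ sliceDom Ω) :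
    conj z ∈ sliceDom Ω := by
  obtain ⟨E, rfl⟩ := h
  rw [mem_sliceDom_circ] at hz ⊢
  rw [Complex.conj_conj]
  exact hz.symm

theorem IsCircular.subset_quadCone {Ω : Set A} (h : IsCircular Ω) : Ω ⊆ quadCone A := by
  obtain ⟨E, rfl⟩ := h
  rintro x ⟨z, -, J, hJ, rfl⟩
  exact pt_mem_quadCone hJ z

theorem IsCircular.coord_mem_iff {Ω : Set A} (h : IsCircular Ω) {x : A} (hx : x ∈ quadCone A) :
    coord x ∈ sliceDom Ω ↔ x ∈ Ω := by
  obtain ⟨J, hJ, e⟩ := exists_eq_pt_coord hx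
  rw [← h.pt_mem_iff hJ, ← e]

theorem IsCircular.nonempty_sliceDom {Ω : Set A} (h : IsCircular Ω) (hne : Ω.Nonempty) :
    (sliceDom Ω).Nonempty := by
  obtain ⟨x, hx⟩ := hne
  exact ⟨_, (h.coord_mem_iff (h.subset_quadCone hx)).2 hx⟩

theorem IsCircularOpen.isCircular {Ω : Set A} (h : IsCircularOpen Ω) : IsCircular Ω := h.1

theorem IsCircularOpen.isOpen_sliceDom {Ω : Set A} (h : IsCircularOpen Ω) :
    IsOpen (sliceDom Ω) := by
  have hc := h.isCircular
  obtain ⟨-, U, hU, e⟩ := h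
  have : sliceDom Ω = pt (someUnit A) ⁻¹' U := by
    ext z
    rw [← hc.pt_mem_iff (someUnit_mem (A := A)), Set.mem_preimage]
    constructor
    · intro h; rw [e] at h; exact h.1
    · intro h; rw [e]; exact ⟨h, pt_mem_quadCone someUnit_mem z⟩
  rw [this]
  exact hU.preimage (continuous_pt _)

attribute [local instance] IsSliceAlg.finiteDimensional

/-- The involution as a linear map. -/
def starₗ : A →ₗ[ℝ] A where
  toFun := star
  map_add' := star_add
  map_smul' := star_smul_A

theorem continuous_star_A : Continuous (star : A → A) :=
  (starₗ : A →ₗ[ℝ] A).continuous_of_finiteDimensional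

theorem continuousOn_coord : ContinuousOn (coord : A → ℂ) (quadCone A) := by
  have h1 : Continuous (reA : A → A) := by
    unfold reA; exact (continuous_id.add continuous_star_A).const_smul _
  have h2 : Continuous (imA : A → A) := by
    unfold imA; exact (continuous_id.sub continuous_star_A).const_smul _
  -- `reR` is defined by choice; on the cone it agrees with a linear functional normalized at `1`,
  -- which makes continuity visible.
  obtain ⟨l, hl⟩ := SeparatingDual.exists_eq_one (R := ℝ) (IsSliceAlg.one_ne_zero (A := A))
  have h3 : ∀ x ∈ quadCone A, reR x = l (reA x) := by
    intro x hx
    obtain ⟨J, hJ, z, rfl⟩ := mem_quadCone_iff.1 hx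
    rw [reR_pt hJ, reA_pt hJ, map_smul, hl, smul_eq_mul, mul_one]
  have h4 : ContinuousOn (fun x : A => ((l (reA x) : ℝ) : ℂ) + (‖imA x‖ : ℝ) * Complex.I)
      (quadCone A) := by
    apply Continuous.continuousOn
    have := l.continuous
    fun_prop
  refine h4.congr fun x hx => ?_
  apply Complex.ext <;> simp [coord, h3 x hx]

/-- The circularization is the preimage of `E` in the cone under the continuous map `coord`. -/
theorem isCircularOpen_circ {E : Set ℂ} (hE : IsOpen E) (hconj : ∀ z ∈ E, conj z ∈ E) :
    IsCircularOpen (circ (A := A) E) := by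
  refine ⟨⟨E, rfl⟩, ?_⟩
  obtain ⟨U, hU, h⟩ := continuousOn_iff'.1 (continuousOn_coord (A := A)) E hE
  refine ⟨U, hU, ?_⟩
  rw [← h]
  have hc : IsCircular (circ (A := A) E) := ⟨E, rfl⟩
  ext x
  constructor
  · intro hx
    have hq := hc.subset_quadCone hx
    exact ⟨by simpa [sliceDom_circ hconj] using (hc.coord_mem_iff hq).2 hx, hq⟩
  · rintro ⟨hx, hq⟩
    exact (hc.coord_mem_iff hq).1 (by rwa [sliceDom_circ hconj])

end CircularSets

/-! ### Algebra of stem functions; the inverse of a tame function. -/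

section SliceCalculus

variable {A : Type*} [NormedStarAlg A] [IsSliceAlg A]

theorem Induces.mono_set {Ω Ω₁ : Set A} (h : Ω₁ ⊆ Ω) {F : ℂ → A × A} {f : A → A}
    (hf : Induces Ω F f) : Induces Ω₁ F f :=
  fun z ⟨J, hJ, hz⟩ => hf z ⟨J, hJ, h hz⟩

theorem sliceDom_mono {Ω Ω₁ : Set A} (h : Ω₁ ⊆ Ω) : sliceDom Ω₁ ⊆ sliceDom Ω :=
  fun _ ⟨J, hJ, hz⟩ => ⟨J, hJ, h hz⟩

theorem stem_congr {Ω : Set A} (hc : IsCircular Ω) {f g : A → A} (h : ∀ x ∈ Ω, f x = g x) {z : ℂ}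
    (hz : z ∈ sliceDom Ω) : stem f z = stem g z := by
  have h1 := h _ ((hc.pt_mem_iff someUnit_mem).2 hz)
  have h2 := h _ ((hc.pt_mem_iff someUnit_mem).2 (hc.conj_mem hz))
  simp only [stem, h1, h2]

theorem IsCircular.stem_eq {Ω : Set A} (hc : IsCircular Ω) {F : ℂ → A × A} {f : A → A}
    (hF : IsStem (sliceDom Ω) F) (hf : Induces Ω F f) {z : ℂ} (hz : z ∈ sliceDom Ω) :
    stem f z = F z :=
  SliceReg.stem_eq hF (fun _ => hc.conj_mem) hf hz

theorem IsSlice.isStem_stem {Ω : Set A} {f : A → A} (h : IsSlice Ω f) :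
    IsStem (sliceDom Ω) (stem f) := by
  obtain ⟨-, hc, F, hF, hf⟩ := h
  have hc : IsCircular Ω := hc
  intro z hz
  rw [hc.stem_eq hF hf hz, hc.stem_eq hF hf (hc.conj_mem hz), hF z hz]

theorem IsSlice.induces_stem {Ω : Set A} {f : A → A} (h : IsSlice Ω f) :
    Induces Ω (stem f) f := by
  obtain ⟨-, hc, F, hF, hf⟩ := h
  intro z hz
  rw [IsCircular.stem_eq hc hF hf hz]
  exact hf z hz

theorem IsCircular.stem_ind {Ω : Set A} (hc : IsCircular Ω) {F : ℂ → A × A}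
    (hF : IsStem (sliceDom Ω) F) {z : ℂ} (hz : z ∈ sliceDom Ω) : stem (ind F) z = F z :=
  hc.stem_eq hF (induces_ind hF) hz

theorem IsStem.cmul {D : Set ℂ} {F G : ℂ → A × A} (hF : IsStem D F) (hG : IsStem D G) :
    IsStem D (fun z => cmul (F z) (G z)) := by
  intro z hz
  simp only [hF z hz, hG z hz, cconj_cmul]

theorem IsStem.cstar {D : Set ℂ} {F : ℂ → A × A} (hF : IsStem D F) :
    IsStem D (fun z => cstar (F z)) := by
  intro z hz
  simp only [hF z hz, cconj_cstar]

theorem IsStem.csmul {D : Set ℂ} {u : ℂ → ℂ} {F : ℂ → A × A}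
    (hu : ∀ z ∈ D, u (conj z) = conj (u z)) (hF : IsStem D F) :
    IsStem D (fun z => csmul (u z) (F z)) := by
  intro z hz
  simp only [hF z hz, hu z hz, cconj_csmul]

theorem IsStem.mono {D D' : Set ℂ} {F : ℂ → A × A} (hF : IsStem D F) (h : D' ⊆ D) :
    IsStem D' F := fun z hz => hF z (h hz)

theorem isStem_const_real (D : Set ℂ) (a : A) : IsStem D (fun _ => (a, (0 : A))) := by
  intro z _
  simp [cconj]

variable (A) in
/-- A real linear functional on `A` with value `1` at the unit. -/
def oneFunctional : StrongDual ℝ A :=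
  (SeparatingDual.exists_eq_one (R := ℝ) (IsSliceAlg.one_ne_zero (A := A))).choose

theorem oneFunctional_one : oneFunctional A 1 = 1 :=
  (SeparatingDual.exists_eq_one (R := ℝ) (IsSliceAlg.one_ne_zero (A := A))).choose_spec

/-- The complexification of `oneFunctional`. -/
def scal : A × A →ₗ[ℝ] ℂ where
  toFun p := ⟨oneFunctional A p.1, oneFunctional A p.2⟩
  map_add' p q := by apply Complex.ext <;> simp
  map_smul' r p := by apply Complex.ext <;> simp

theorem scal_apply (p : A × A) : scal p = ⟨oneFunctional A p.1, oneFunctional A p.2⟩ := rfl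

theorem scal_csmul (u : ℂ) (p : A × A) : scal (csmul u p) = u * scal p := by
  apply Complex.ext <;> simp [scal_apply, csmul, Complex.mul_re, Complex.mul_im]

theorem scal_one : scal ((1 : A), (0 : A)) = 1 := by
  apply Complex.ext <;> simp [scal_apply, oneFunctional_one]

theorem scal_csmul_one (u : ℂ) : scal (csmul u ((1 : A), (0 : A))) = u := by
  rw [scal_csmul, scal_one, mul_one]

theorem scal_cconj (p : A × A) : scal (cconj p) = conj (scal p) := by
  apply Complex.ext <;> simp [scal_apply, cconj]

/-- The stem function of `N(f)`, as a complex function; this is meant for tame `f`. -/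
def normStem (f : A → A) (z : ℂ) : ℂ := scal (cmul (stem f z) (cstar (stem f z)))

/-- The stem function of `f^{-•}`. -/
def invStem (f : A → A) (z : ℂ) : A × A := csmul (normStem f z)⁻¹ (cstar (stem f z))

section

variable {Ω : Set A} {f : A → A}

theorem IsSlice.stem_sliceConj (h : IsSlice Ω f) {z : ℂ} (hz : z ∈ sliceDom Ω) :
    stem (sliceConj f) z = cstar (stem f z) :=
  IsCircular.stem_ind h.2.1 h.isStem_stem.cstar hz

theorem IsSlice.isStem_stem_sliceConj (h : IsSlice Ω f) :
    IsStem (sliceDom Ω) (stem (sliceConj f)) := by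
  intro z hz
  rw [h.stem_sliceConj hz, h.stem_sliceConj (IsCircular.conj_mem h.2.1 hz)]
  exact h.isStem_stem.cstar z hz

theorem IsSlice.sliceConj (h : IsSlice Ω f) : IsSlice Ω (sliceConj f) :=
  ⟨h.1, h.2.1, _, h.isStem_stem.cstar, induces_ind h.isStem_stem.cstar⟩

theorem IsSlice.stem_normalFn (h : IsSlice Ω f) {z : ℂ} (hz : z ∈ sliceDom Ω) :
    stem (normalFn f) z = cmul (stem f z) (cstar (stem f z)) := by
  rw [normalFn, sliceMul, IsCircular.stem_ind h.2.1 (h.isStem_stem.cmul h.isStem_stem_sliceConj) hz,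
    h.stem_sliceConj hz]

theorem IsSlice.isStem_normal (h : IsSlice Ω f) :
    IsStem (sliceDom Ω) (fun z => cmul (stem f z) (cstar (stem f z))) :=
  h.isStem_stem.cmul h.isStem_stem.cstar

theorem IsSlice.induces_normalFn (h : IsSlice Ω f) :
    Induces Ω (fun z => SliceReg.cmul (stem f z) (SliceReg.cstar (stem f z))) (normalFn f) := by
  have h1 : IsStem (sliceDom Ω) (fun z => SliceReg.cmul (stem f z) (stem (SliceReg.sliceConj f) z)) :=
    h.isStem_stem.cmul h.isStem_stem_sliceConj
  intro z hz J hJ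
  rw [normalFn, sliceMul, induces_ind h1 z hz J hJ]
  simp only [h.stem_sliceConj hz]

/-- A stem function with real components has its values in the centre `ℝ + ιℝ`, and `scal` reads off
the scalar. -/
theorem IsTame.cmul_cstar (h : IsTame Ω f) {z : ℂ} (hz : z ∈ sliceDom Ω) :
    cmul (stem f z) (cstar (stem f z)) = csmul (normStem f z) (1, 0) := by
  obtain ⟨hs, ⟨-, hc, F, hF, hi, hreal⟩, -⟩ := h
  obtain ⟨a, b, hab⟩ := hreal z hz
  have h1 := IsCircular.stem_eq hc hF hi hz
  rw [hs.stem_normalFn hz, hab] at h1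
  have h2 : ((a • (1 : A), b • (1 : A)) : A × A) = csmul ⟨a, b⟩ (1, 0) := by rw [csmul_one_eq]
  rw [normStem, h1, h2, scal_csmul_one]

/-- The condition `N(f) = N(f^c)` enters here; it is what makes the inverse two-sided. -/
theorem IsTame.cstar_cmul (h : IsTame Ω f) {z : ℂ} (hz : z ∈ sliceDom Ω) :
    cmul (cstar (stem f z)) (stem f z) = csmul (normStem f z) (1, 0) := by
  rw [← h.cmul_cstar hz, ← h.1.stem_normalFn hz, stem_congr h.1.2.1 h.2.2 hz,
    h.1.sliceConj.stem_normalFn hz, h.1.stem_sliceConj hz, cstar_cstar]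

theorem IsSlice.normStem_conj (h : IsSlice Ω f) {z : ℂ} (hz : z ∈ sliceDom Ω) :
    normStem f (conj z) = conj (normStem f z) := by
  rw [normStem, normStem, ← scal_cconj]
  exact congrArg scal (h.isStem_normal z hz)

theorem IsTame.normalFn_pt (h : IsTame Ω f) {J : A} (hJ : J ∈ imagUnits A) {z : ℂ}
    (hz : z ∈ sliceDom Ω) : normalFn f (pt J z) = pt J (normStem f z) := by
  rw [h.1.induces_normalFn z hz J hJ]
  beta_reduce
  rw [h.cmul_cstar hz]
  exact ev_csmul_one J _

theorem IsTame.isStem_invStem (h : IsTame Ω f) : IsStem (sliceDom Ω) (invStem f) :=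
  IsStem.csmul (fun z hz => by rw [h.1.normStem_conj hz, map_inv₀]) h.1.isStem_stem.cstar

/-- This holds even at the zeros of `N(f)`: there `coneInv` and the inverse in `ℂ` both take the
value `0`. -/
theorem IsTame.induces_invStem (h : IsTame Ω f) : Induces Ω (invStem f) (sliceInv f) := by
  intro z hz J hJ
  rw [sliceInv, h.normalFn_pt hJ hz, coneInv_pt hJ]
  have h1 : SliceReg.sliceConj f (pt J z) = ev J (cstar (stem f z)) :=
    induces_ind h.1.isStem_stem.cstar z hz J hJ
  rw [h1, ← ev_csmul hJ]
  rfl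

theorem IsTame.setOf_normalFn_ne_zero (h : IsTame Ω f) :
    {x ∈ Ω | normalFn f x ≠ 0} = circ {z ∈ sliceDom Ω | normStem f z ≠ 0} := by
  have hc : IsCircular Ω := h.1.2.1
  ext x
  constructor
  · rintro ⟨hx, hne⟩
    obtain ⟨J, hJ, e⟩ := exists_eq_pt_coord (hc.subset_quadCone hx)
    have hz := (hc.coord_mem_iff (hc.subset_quadCone hx)).2 hx
    rw [e, h.normalFn_pt hJ hz, Ne, pt_eq_zero_iff hJ] at hne
    exact ⟨_, ⟨hz, hne⟩, J, hJ, e⟩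
  · rintro ⟨z, ⟨hz, hne⟩, J, hJ, rfl⟩
    refine ⟨(hc.pt_mem_iff hJ).2 hz, ?_⟩
    rw [h.normalFn_pt hJ hz, Ne, pt_eq_zero_iff hJ]
    exact hne

theorem IsTame.conj_mem_ne_zero (h : IsTame Ω f) :
    ∀ z ∈ {z ∈ sliceDom Ω | normStem f z ≠ 0}, conj z ∈ {z ∈ sliceDom Ω | normStem f z ≠ 0} := by
  rintro z ⟨hz, hne⟩
  refine ⟨IsCircular.conj_mem h.1.2.1 hz, ?_⟩
  rw [h.1.normStem_conj hz]
  simpa using hne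

theorem IsTame.sliceDom_ne_zero (h : IsTame Ω f) :
    sliceDom {x ∈ Ω | normalFn f x ≠ 0} = {z ∈ sliceDom Ω | normStem f z ≠ 0} := by
  rw [h.setOf_normalFn_ne_zero, sliceDom_circ h.conj_mem_ne_zero]

theorem IsTame.isCircular_ne_zero (h : IsTame Ω f) :
    IsCircular {x ∈ Ω | normalFn f x ≠ 0} :=
  ⟨_, h.setOf_normalFn_ne_zero⟩

theorem IsTame.isStem_invStem_ne_zero (h : IsTame Ω f) :
    IsStem (sliceDom {x ∈ Ω | normalFn f x ≠ 0}) (invStem f) :=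
  h.isStem_invStem.mono (sliceDom_mono fun _ hx => hx.1)

theorem IsTame.induces_invStem_ne_zero (h : IsTame Ω f) :
    Induces {x ∈ Ω | normalFn f x ≠ 0} (invStem f) (sliceInv f) :=
  Induces.mono_set (fun _ hx => hx.1) h.induces_invStem

theorem IsTame.isSlice_sliceInv (h : IsTame Ω f) (hne : {x ∈ Ω | normalFn f x ≠ 0}.Nonempty) :
    IsSlice {x ∈ Ω | normalFn f x ≠ 0} (sliceInv f) :=
  ⟨hne, h.isCircular_ne_zero, invStem f, h.isStem_invStem_ne_zero, h.induces_invStem_ne_zero⟩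

theorem IsTame.stem_sliceInv (h : IsTame Ω f) {z : ℂ} (hz : z ∈ sliceDom Ω) :
    stem (sliceInv f) z = invStem f z :=
  IsCircular.stem_eq h.1.2.1 h.isStem_invStem h.induces_invStem hz

/-- Only the centrality of the scalar `ν⁻¹` is used, so the lack of associativity is harmless. -/
theorem IsTame.cmul_invStem (h : IsTame Ω f) {z : ℂ} (hz : z ∈ sliceDom Ω)
    (hne : normStem f z ≠ 0) : cmul (stem f z) (invStem f z) = (1, 0) := by
  rw [invStem, cmul_csmul, h.cmul_cstar hz, csmul_csmul, inv_mul_cancel₀ hne, csmul_one]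

theorem IsTame.invStem_cmul (h : IsTame Ω f) {z : ℂ} (hz : z ∈ sliceDom Ω)
    (hne : normStem f z ≠ 0) : cmul (invStem f z) (stem f z) = (1, 0) := by
  rw [invStem, csmul_cmul, h.cstar_cmul hz, csmul_csmul, inv_mul_cancel₀ hne, csmul_one]

theorem IsTame.sliceMul_sliceInv (h : IsTame Ω f) {x : A}
    (hx : x ∈ {x ∈ Ω | normalFn f x ≠ 0}) :
    sliceMul f (sliceInv f) x = 1 ∧ sliceMul (sliceInv f) f x = 1 := by
  have hq := h.isCircular_ne_zero.subset_quadCone hx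
  have hz := (h.isCircular_ne_zero.coord_mem_iff hq).2 hx
  rw [h.sliceDom_ne_zero] at hz
  simp only [sliceMul, ind, h.stem_sliceInv hz.1, h.cmul_invStem hz.1 hz.2,
    h.invStem_cmul hz.1 hz.2, mul_zero, add_zero, and_self]

/-- Both normal functions of `f^{-•}` have stem function `ν⁻¹ ν⁻¹ ν = ν⁻¹`; they use `F^c F` and `F
F^c` respectively. -/
theorem IsTame.isTame_sliceInv (h : IsTame Ω f) (hne : {x ∈ Ω | normalFn f x ≠ 0}.Nonempty) :
    IsTame {x ∈ Ω | normalFn f x ≠ 0} (sliceInv f) := by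
  have hs := h.isSlice_sliceInv hne
  have hc := h.isCircular_ne_zero
  have h1 : ∀ z ∈ sliceDom {x ∈ Ω | normalFn f x ≠ 0},
      cmul (stem (sliceInv f) z) (cstar (stem (sliceInv f) z)) =
        csmul (normStem f z)⁻¹ (1, 0) := by
    intro z hz
    rw [h.sliceDom_ne_zero] at hz
    rw [h.stem_sliceInv hz.1, invStem, cstar_csmul, cstar_cstar, cmul_csmul, csmul_cmul,
      h.cstar_cmul hz.1, csmul_csmul, csmul_csmul,
      mul_assoc, inv_mul_cancel₀ hz.2, mul_one]
  have h2 : ∀ z ∈ sliceDom {x ∈ Ω | normalFn f x ≠ 0},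
      cmul (stem (SliceReg.sliceConj (sliceInv f)) z)
        (cstar (stem (SliceReg.sliceConj (sliceInv f)) z)) = csmul (normStem f z)⁻¹ (1, 0) := by
    intro z hz
    rw [hs.stem_sliceConj hz, cstar_cstar]
    rw [h.sliceDom_ne_zero] at hz
    rw [h.stem_sliceInv hz.1, invStem, cstar_csmul, cstar_cstar, cmul_csmul, csmul_cmul,
      h.cmul_cstar hz.1, csmul_csmul, csmul_csmul,
      mul_assoc, inv_mul_cancel₀ hz.2, mul_one]
  refine ⟨hs, ⟨hne, hc, _, hs.isStem_normal, hs.induces_normalFn, ?_⟩, ?_⟩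
  · intro z hz
    exact ⟨_, _, (h1 z hz).trans (csmul_one_eq _)⟩
  · intro x hx
    have hq := hc.subset_quadCone hx
    have hz := (hc.coord_mem_iff hq).2 hx
    obtain ⟨J, hJ, e⟩ := exists_eq_pt_coord hq
    rw [e, hs.induces_normalFn _ hz J hJ, hs.sliceConj.induces_normalFn _ hz J hJ]
    beta_reduce
    rw [h1 _ hz, h2 _ hz]

end

end SliceCalculus

/-! ### Complex analysis of vector-valued power and Laurent series. -/

section Expansions

variable {E : Type*} [NormedAddCommGroup E] [NormedSpace ℂ E] [CompleteSpace E]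

theorem hasSum_int_iff_of_eq_zero {M : Type*} [AddCommMonoid M] [TopologicalSpace M] {s : ℤ → M}
    {k : ℕ} (hs : ∀ n : ℤ, n < -(k : ℤ) → s n = 0) {S : M} : HasSum s S ↔ HasSum (fun j : ℕ => s ((j : ℤ) - k)) S := by
  have hinj : Function.Injective (fun j : ℕ => (j : ℤ) - k) := by
    intro i j h
    simpa using h
  refine (hinj.hasSum_iff (f := s) ?_).symm
  intro n hn
  refine hs n ?_
  by_contra hlt
  exact hn ⟨(n + k).toNat, by simp only; omega⟩

/-- Abel's comparison: bounded terms at radius `ρ` are dominated by a geometric series on half that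
radius. -/
theorem norm_pow_smul_le_geometric {ρ C : ℝ} {v : ℕ → E}
    (hv : ∀ j, ρ ^ j * ‖v j‖ ≤ C) {w : ℂ} (hw : ‖w‖ ≤ ρ / 2) (j : ℕ) :
    ‖w ^ j • v j‖ ≤ C * (1 / 2) ^ j := by
  rw [norm_smul, norm_pow]
  calc ‖w‖ ^ j * ‖v j‖ ≤ (ρ / 2) ^ j * ‖v j‖ := by gcongr
    _ = (ρ ^ j * ‖v j‖) * (1 / 2) ^ j := by rw [div_pow, one_div, inv_pow]; ring
    _ ≤ C * (1 / 2) ^ j := by gcongr; exact hv j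

theorem differentiableOn_tsum_pow {ρ C : ℝ} {v : ℕ → E}
    (hv : ∀ j, ρ ^ j * ‖v j‖ ≤ C) :
    DifferentiableOn ℂ (fun w : ℂ => ∑' j : ℕ, w ^ j • v j) (Metric.ball 0 (ρ / 2)) := by
  refine Complex.differentiableOn_tsum_of_summable_norm (u := fun j => C * (1 / 2) ^ j)
    (summable_geometric_two.mul_left C) (fun j => ?_) Metric.isOpen_ball fun j w hw => ?_
  · exact (differentiableOn_id.pow j).smul_const _
  · exact norm_pow_smul_le_geometric hv (by simpa using (Metric.mem_ball.1 hw).le) j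

theorem exists_bound_of_summable {s : ℕ → E} (hs : Summable s) : ∃ C, ∀ j, ‖s j‖ ≤ C := by
  obtain ⟨C, hC⟩ := (hs.tendsto_atTop_zero.norm).bddAbove_range
  exact ⟨C, fun j => hC ⟨j, rfl⟩⟩

/-- The sum of a Laurent series with finite principal part has at most a pole. -/
theorem exists_analyticAt_of_hasSum_zpow {z₀ : ℂ} {R : ℝ} (hR : 0 < R) {k : ℕ} {b : ℤ → E}
    (hb : ∀ n : ℤ, n < -(k : ℤ) → b n = 0) {F : ℂ → E}
    (hF : ∀ z, 0 < ‖z - z₀‖ → ‖z - z₀‖ < R → HasSum (fun n : ℤ => (z - z₀) ^ n • b n) (F z)) :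
    ∃ P : ℂ → E, AnalyticAt ℂ P z₀ ∧ ∀ᶠ z in 𝓝[≠] z₀, (z - z₀) ^ k • F z = P z := by
  set v : ℕ → E := fun j => b ((j : ℤ) - k) with hv
  have key : ∀ z, 0 < ‖z - z₀‖ → ‖z - z₀‖ < R →
      HasSum (fun j : ℕ => (z - z₀) ^ j • v j) ((z - z₀) ^ k • F z) := by
    intro z h0 h1
    have hz : z - z₀ ≠ 0 := norm_pos_iff.1 h0
    have h2 := (hasSum_int_iff_of_eq_zero (k := k)
      (fun n hn => by rw [hb n hn, smul_zero])).1 (hF z h0 h1)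
    have h3 := h2.const_smul ((z - z₀) ^ k)
    refine h3.congr_fun fun j => ?_
    rw [smul_smul, ← zpow_natCast (z - z₀) k, ← zpow_add₀ hz, add_sub_cancel, zpow_natCast]
  -- Convergence at the single point `z₀ + R/2` bounds the coefficients, and this gives analyticity
  -- in the disc of radius `R/4`.
  have hρ : (0 : ℝ) < R / 2 := by positivity
  have hn : ‖(z₀ + ((R / 2 : ℝ) : ℂ)) - z₀‖ = R / 2 := by
    rw [add_sub_cancel_left, Complex.norm_real, Real.norm_of_nonneg hρ.le]
  have h1 := key (z₀ + ((R / 2 : ℝ) : ℂ)) (by rw [hn]; exact hρ) (by rw [hn]; linarith)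
  obtain ⟨C, hC⟩ := exists_bound_of_summable h1.summable
  have hd := differentiableOn_tsum_pow (v := v) (C := C) fun j => by
    have := hC j
    rwa [norm_smul, norm_pow, hn] at this
  have ha : AnalyticAt ℂ (fun w : ℂ => ∑' j : ℕ, w ^ j • v j) (z₀ - z₀) := by
    rw [sub_self]
    exact hd.analyticAt (Metric.ball_mem_nhds _ (by positivity))
  refine ⟨fun z => ∑' j : ℕ, (z - z₀) ^ j • v j,
    ha.fun_comp (f := fun z => z - z₀) (by fun_prop), ?_⟩
  have hball : Metric.ball z₀ R ∈ 𝓝[≠] z₀ := mem_nhdsWithin_of_mem_nhds (Metric.ball_mem_nhds _ hR)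
  filter_upwards [hball, self_mem_nhdsWithin] with z hz hne
  have hne' : 0 < ‖z - z₀‖ := norm_pos_iff.2 (sub_ne_zero.2 hne)
  exact (key z hne' (by simpa [dist_eq_norm] using hz)).tsum_eq.symm

theorem exists_hasSum_of_analyticAt {P : ℂ → E} {z₀ : ℂ} (hP : AnalyticAt ℂ P z₀) :
    ∃ R > 0, ∃ v : ℕ → E, ∀ z, ‖z - z₀‖ < R → HasSum (fun j : ℕ => (z - z₀) ^ j • v j) (P z) := by
  obtain ⟨p, hp⟩ := hP
  obtain ⟨R, hR, h⟩ := Metric.eventually_nhds_iff.1 (hasFPowerSeriesAt_iff'.1 hp)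
  exact ⟨R, hR, p.coeff, fun z hz => h (by rwa [dist_eq_norm])⟩

/-- A function analytic at `z₀` and at `conj z₀` is, near these two points, a power series in
`w = (z - z₀) (z - conj z₀)` with coefficients affine in `z`. -/
theorem exists_hasSum_cassini {z₀ : ℂ} (h0 : z₀.im ≠ 0) {H : ℂ → E} (h1 : AnalyticAt ℂ H z₀)
    (h2 : AnalyticAt ℂ H (conj z₀)) :
    ∃ r > 0, ∃ U V : ℕ → E, ∀ z, ‖(z - z₀) * (z - conj z₀)‖ < r → ∃ u v : E,
      HasSum (fun j : ℕ => ((z - z₀) * (z - conj z₀)) ^ j • U j) u ∧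
      HasSum (fun j : ℕ => ((z - z₀) * (z - conj z₀)) ^ j • V j) v ∧
      H z = u + (z - z₀.re) • v := by
  set a : ℂ := (z₀.re : ℂ) with ha
  set b : ℂ := (z₀.im : ℂ) with hb
  have hb0 : b ≠ 0 := by simpa [hb] using h0
  have hz0 : z₀ = a + Complex.I * b := by
    rw [ha, hb, mul_comm]; exact (Complex.re_add_im z₀).symm
  have hz0' : conj z₀ = a - Complex.I * b := by
    apply Complex.ext <;> simp [ha, hb]
  -- With `z₀ = a + ib` one has `w = (z - a)² + b²`, so `z - a = ± s(w)` for this branch of the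
  -- square root of `w - b²`, which is analytic at `0` since `b ≠ 0`. The even part `U` of `H(a ±
  -- s)` and its odd part divided by `s`, called `V`, do not depend on the sign, hence `H = U + (z -
  -- a) V` for either one.
  set s : ℂ → ℂ := fun w => Complex.I * b * (1 - w / b ^ 2) ^ (1 / 2 : ℂ) with hs
  have hsa : AnalyticAt ℂ s 0 := by
    refine analyticAt_const.mul (AnalyticAt.cpow (by fun_prop) analyticAt_const ?_)
    simp
  have hs0 : s 0 = Complex.I * b := by simp [hs]
  have hs2 : ∀ w, s w ^ 2 = w - b ^ 2 := by
    intro w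
    have : ((1 - w / b ^ 2) ^ (1 / 2 : ℂ)) ^ 2 = 1 - w / b ^ 2 := by
      rw [← Complex.cpow_nat_mul]
      norm_num
    rw [hs]
    simp only
    rw [mul_pow, this, mul_pow, Complex.I_sq]
    field_simp
    ring
  have hsne : s 0 ≠ 0 := by rw [hs0]; exact mul_ne_zero Complex.I_ne_zero hb0
  have hp : AnalyticAt ℂ (fun w => H (a + s w)) 0 := by
    refine AnalyticAt.fun_comp (g := H) (f := fun w => a + s w) ?_ (analyticAt_const.add hsa)
    rw [hs0, ← hz0]; exact h1
  have hm : AnalyticAt ℂ (fun w => H (a - s w)) 0 := by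
    refine AnalyticAt.fun_comp (g := H) (f := fun w => a - s w) ?_ (analyticAt_const.sub hsa)
    rw [hs0, ← hz0']; exact h2
  have hU : AnalyticAt ℂ (fun w => (1 / 2 : ℂ) • (H (a + s w) + H (a - s w))) 0 :=
    analyticAt_const.smul (hp.add hm)
  have hV : AnalyticAt ℂ (fun w => (2 * s w)⁻¹ • (H (a + s w) - H (a - s w))) 0 :=
    ((analyticAt_const.mul hsa).inv (mul_ne_zero two_ne_zero hsne)).smul (hp.sub hm)
  obtain ⟨r₁, hr₁, U, hU⟩ := exists_hasSum_of_analyticAt hU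
  obtain ⟨r₂, hr₂, V, hV⟩ := exists_hasSum_of_analyticAt hV
  obtain ⟨r₃, hr₃, hne⟩ := Metric.eventually_nhds_iff.1
    (hsa.continuousAt.eventually_ne hsne)
  refine ⟨min r₁ (min r₂ r₃), by positivity, U, V, fun z hz => ?_⟩
  set w := (z - z₀) * (z - conj z₀) with hw
  have hU := hU w (by rw [sub_zero]; exact hz.trans_le (min_le_left _ _))
  have hV := hV w (by
    rw [sub_zero]; exact hz.trans_le ((min_le_right _ _).trans (min_le_left _ _)))
  have hne := @hne w (by
    rw [dist_zero_right]; exact hz.trans_le ((min_le_right _ _).trans (min_le_right _ _)))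
  rw [sub_zero] at hU hV
  refine ⟨_, _, hU, hV, ?_⟩
  have hsq : (z - a) ^ 2 = s w ^ 2 := by
    rw [hs2, hw, hz0', hz0]
    linear_combination b ^ 2 * Complex.I_sq
  rcases sq_eq_sq_iff_eq_or_eq_neg.1 hsq with h | h
  · rw [h, smul_smul, ← h, add_sub_cancel, h]
    have : s w * (2 * s w)⁻¹ = 1 / 2 := by field_simp
    rw [this, ← smul_add]
    module
  · have hz : a - s w = z := by linear_combination -h
    have : (z - a) * (2 * s w)⁻¹ = -(1 / 2) := by rw [h]; field_simp
    rw [smul_smul, this, hz]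
    module

end Expansions

/-! ### Complex coordinates on `A_ℂ`; slice regularity as holomorphy. -/

section ComplexCoordinates

variable {A : Type*} [NormedStarAlg A] [IsSliceAlg A]

attribute [local instance] IsSliceAlg.finiteDimensional

variable (A) in
/-- The complex coordinate space of `A_ℂ`. -/
abbrev CoordSpace : Type := Fin (Module.finrank ℝ A) → ℂ

/-- Complex coordinates on `A_ℂ`, as a linear equivalence. -/
def toCoordₗ : (A × A) ≃ₗ[ℝ] CoordSpace A where
  toFun p := fun i => ⟨(Module.finBasis ℝ A).equivFun p.1 i, (Module.finBasis ℝ A).equivFun p.2 i⟩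
  invFun v := ((Module.finBasis ℝ A).equivFun.symm fun i => (v i).re,
    (Module.finBasis ℝ A).equivFun.symm fun i => (v i).im)
  map_add' p q := by ext i; apply Complex.ext <;> simp
  map_smul' r p := by ext i; apply Complex.ext <;> simp
  left_inv p := by ext <;> simp
  right_inv v := by
    ext i
    apply Complex.ext <;> simp only [LinearEquiv.apply_symm_apply]

/-- Complex coordinates on `A_ℂ`. -/
def toCoord : (A × A) ≃L[ℝ] CoordSpace A := toCoordₗ.toContinuousLinearEquiv

theorem toCoord_apply (p : A × A) (i : Fin (Module.finrank ℝ A)) : toCoord p i =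
    ⟨(Module.finBasis ℝ A).equivFun p.1 i, (Module.finBasis ℝ A).equivFun p.2 i⟩ := rfl

theorem toCoord_csmul (u : ℂ) (p : A × A) : toCoord (csmul u p) = u • toCoord p := by
  ext i
  apply Complex.ext <;> simp [toCoord_apply, csmul]

theorem toCoord_symm_smul (u : ℂ) (v : CoordSpace A) :
    toCoord.symm (u • v) = csmul u (toCoord.symm v) := by
  rw [ContinuousLinearEquiv.symm_apply_eq, toCoord_csmul, ContinuousLinearEquiv.apply_symm_apply]

theorem toCoord_cconj (p : A × A) : toCoord (cconj p) = star (toCoord p) := by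
  ext i
  rw [Pi.star_apply]
  apply Complex.ext <;> simp [toCoord_apply, cconj]

/-- The basis is real, so conjugation of `A_ℂ` is coordinatewise and the `A`-component is the
average of `v` with its conjugate. -/
theorem toCoord_real (v : CoordSpace A) :
    toCoord ((toCoord.symm v).1, 0) = (1 / 2 : ℂ) • (v + star v) := by
  obtain ⟨p, rfl⟩ := toCoord.surjective v
  rw [← toCoord_cconj, ← map_add, ← toCoord_csmul, ContinuousLinearEquiv.symm_apply_apply]
  congr 1
  ext
  · simp only [csmul, cconj, Prod.fst_add, Prod.snd_add]
    norm_num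
    module
  · simp [csmul, cconj]

/-- The map on coordinates induced by a map on `A_ℂ` which commutes with complex scalars. -/
def descend {W : Type*} [NormedAddCommGroup W] [NormedSpace ℂ W] (T : A × A →ₗ[ℝ] W)
    (hT : ∀ (u : ℂ) (p : A × A), T (csmul u p) = u • T p) : CoordSpace A →L[ℂ] W :=
  LinearMap.toContinuousLinearMap
    { toFun := fun v => T (toCoord.symm v)
      map_add' := fun v w => by rw [map_add, map_add]
      map_smul' := fun u v => by rw [toCoord_symm_smul, hT, RingHom.id_apply] }

theorem descend_toCoord {W : Type*} [NormedAddCommGroup W] [NormedSpace ℂ W]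
    (T : A × A →ₗ[ℝ] W) (hT : ∀ (u : ℂ) (p : A × A), T (csmul u p) = u • T p) (p : A × A) :
    descend T hT (toCoord p) = T p := by
  change T (toCoord.symm (toCoord p)) = T p
  rw [ContinuousLinearEquiv.symm_apply_apply]

/-- The involution of `A_ℂ` in coordinates. -/
def cstarCoord : CoordSpace A →L[ℂ] CoordSpace A :=
  descend
    { toFun := fun p => toCoord (cstar p)
      map_add' := fun p q => by rw [← map_add]; congr 1; ext <;> simp [cstar]
      map_smul' := fun r p => by
        rw [RingHom.id_apply, ← map_smul]; congr 1; ext <;> simp [cstar, star_smul_A] }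
    fun u p => by
      change toCoord (cstar (csmul u p)) = u • toCoord (cstar p)
      rw [cstar_csmul, toCoord_csmul]

theorem cstarCoord_toCoord (p : A × A) : cstarCoord (toCoord p) = toCoord (cstar p) :=
  descend_toCoord _ _ p

/-- The functional `scal` in coordinates. -/
def scalCoord : CoordSpace A →L[ℂ] ℂ := descend scal scal_csmul

theorem scalCoord_toCoord (p : A × A) : scalCoord (toCoord p) = scal p :=
  descend_toCoord _ _ p

/-- The product of `A_ℂ` in coordinates. -/
def mulCoord : CoordSpace A →L[ℂ] CoordSpace A →L[ℂ] CoordSpace A :=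
  LinearMap.toContinuousBilinearMap <|
    LinearMap.mk₂ ℂ (fun v w => toCoord (cmul (toCoord.symm v) (toCoord.symm w)))
      (fun v v' w => by rw [map_add, add_cmul, map_add])
      (fun u v w => by rw [toCoord_symm_smul, csmul_cmul, toCoord_csmul])
      (fun v w w' => by rw [map_add, cmul_add, map_add])
      (fun u v w => by rw [toCoord_symm_smul, cmul_csmul, toCoord_csmul])

theorem mulCoord_toCoord (p q : A × A) :
    mulCoord (toCoord p) (toCoord q) = toCoord (cmul p q) := by
  change toCoord (cmul (toCoord.symm (toCoord p)) (toCoord.symm (toCoord q))) = _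
  rw [ContinuousLinearEquiv.symm_apply_apply, ContinuousLinearEquiv.symm_apply_apply]

/-- The map `ev J` in coordinates. -/
def evCoord (J : A) : CoordSpace A →L[ℝ] A :=
  LinearMap.toContinuousLinearMap
    { toFun := fun v => ev J (toCoord.symm v)
      map_add' := fun v w => by simp only [map_add, ev, Prod.fst_add, Prod.snd_add, mul_add]; abel
      map_smul' := fun r v => by
        simp only [map_smul, ev, Prod.smul_fst, Prod.smul_snd, mul_smul_A, smul_add,
          RingHom.id_apply] }

theorem evCoord_apply (J : A) (v : CoordSpace A) : evCoord J v = ev J (toCoord.symm v) := rfl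

theorem evCoord_toCoord (J : A) (p : A × A) : evCoord J (toCoord p) = ev J p := by
  rw [evCoord_apply, ContinuousLinearEquiv.symm_apply_apply]

/-- The map `eps J` in coordinates. -/
def epsCoord (J : A) : A →L[ℝ] CoordSpace A :=
  LinearMap.toContinuousLinearMap
    { toFun := fun x => toCoord (eps J x)
      map_add' := fun x y => by
        rw [← map_add]; congr 1
        ext <;> simp only [eps, mul_add, Prod.fst_add, Prod.snd_add] <;> module
      map_smul' := fun r x => by
        rw [RingHom.id_apply, ← map_smul]; congr 1
        ext <;> simp only [eps, mul_smul_A, Prod.smul_fst, Prod.smul_snd] <;> module }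

theorem epsCoord_apply (J : A) (x : A) : epsCoord J x = toCoord (eps J x) := rfl

theorem evCoord_smul {J : A} (hJ : J ∈ imagUnits A) (u : ℂ) (v : CoordSpace A) :
    evCoord J (u • v) = pt J u * evCoord J v := by
  rw [evCoord_apply, toCoord_symm_smul, ev_csmul hJ, evCoord_apply]

theorem epsCoord_pt_mul {J : A} (hJ : J ∈ imagUnits A) (u : ℂ) (x : A) :
    epsCoord J (pt J u * x) = u • epsCoord J x := by
  rw [epsCoord_apply, eps_pt_mul hJ, toCoord_csmul, epsCoord_apply]

/-- The stem function in coordinates. -/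
def stemCoord (f : A → A) (z : ℂ) : CoordSpace A := toCoord (stem f z)

/-- The stem function of `f^{-•}` in coordinates. -/
def invCoord (f : A → A) (z : ℂ) : CoordSpace A := toCoord (invStem f z)

theorem normStem_eq (f : A → A) (z : ℂ) :
    normStem f z = scalCoord (mulCoord (stemCoord f z) (cstarCoord (stemCoord f z))) := by
  rw [stemCoord, cstarCoord_toCoord, mulCoord_toCoord, scalCoord_toCoord, normStem]

theorem invCoord_eq (f : A → A) (z : ℂ) :
    invCoord f z = (normStem f z)⁻¹ • cstarCoord (stemCoord f z) := by
  rw [stemCoord, cstarCoord_toCoord, ← toCoord_csmul, invCoord, invStem]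

theorem csmul_I_csmul_I (p : A × A) : csmul Complex.I (csmul Complex.I p) = -p := by
  ext <;> simp [csmul]

/-- These are the Cauchy–Riemann equations: multiplication by `ι` turns `∂_α F = -ι ∂_β F` into `∂_β
F = ι ∂_α F`. -/
theorem dbar_eq_zero_iff {F : ℂ → A × A} {z : ℂ} (hF : DifferentiableAt ℝ F z) :
    dbar F z = 0 ↔ DifferentiableAt ℂ (fun z => toCoord (F z)) z := by
  have h1 : fderiv ℝ (fun z => toCoord (F z)) z =
      ((toCoord : (A × A) ≃L[ℝ] CoordSpace A) : (A × A) →L[ℝ] CoordSpace A).comp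
        (fderiv ℝ F z) :=
    (toCoord : (A × A) ≃L[ℝ] CoordSpace A).comp_fderiv
  rw [differentiableAt_complex_iff_differentiableAt_real, h1]
  have h2 : DifferentiableAt ℝ (fun z => toCoord (F z)) z :=
    (toCoord : (A × A) ≃L[ℝ] CoordSpace A).differentiableAt.comp z hF
  simp only [h2, true_and, ContinuousLinearMap.comp_apply, ContinuousLinearEquiv.coe_coe]
  rw [← toCoord_csmul, toCoord.injective.eq_iff, dbar, smul_eq_zero]
  have h3 : ¬ (1 / 2 : ℝ) = 0 := by norm_num
  simp only [h3, false_or]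
  constructor
  · intro h
    rw [eq_neg_of_add_eq_zero_left h]
    have := csmul_I_csmul_I (fderiv ℝ F z Complex.I)
    have h4 : csmul Complex.I (-csmul Complex.I (fderiv ℝ F z Complex.I)) =
        -csmul Complex.I (csmul Complex.I (fderiv ℝ F z Complex.I)) := by
      ext <;> simp [csmul]
    rw [h4, this, neg_neg]
  · intro h
    rw [h, csmul_I_csmul_I, add_neg_cancel]

theorem IsSliceRegular.isSlice {Ω : Set A} {f : A → A} (h : IsSliceRegular Ω f) : IsSlice Ω f := by
  obtain ⟨hne, ho, F, hF, hi, -⟩ := h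
  exact ⟨hne, ho.1, F, hF, hi⟩

theorem IsSliceRegular.differentiableOn {Ω : Set A} {f : A → A} (h : IsSliceRegular Ω f) :
    DifferentiableOn ℂ (stemCoord f) (sliceDom Ω) := by
  obtain ⟨hne, ho, F, hF, hi, hd, hdb⟩ := h
  have hD := ho.isOpen_sliceDom
  have h1 : DifferentiableOn ℂ (fun z => toCoord (F z)) (sliceDom Ω) := by
    intro z hz
    refine DifferentiableAt.differentiableWithinAt ?_
    refine (dbar_eq_zero_iff ?_).1 (hdb z hz)
    exact (hd.differentiableOn one_ne_zero).differentiableAt (hD.mem_nhds hz)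
  refine h1.congr fun z hz => ?_
  rw [stemCoord, ho.isCircular.stem_eq hF hi hz]

theorem isSliceRegular_of_differentiableOn {Ω : Set A} {f : A → A} (hne : Ω.Nonempty)
    (ho : IsCircularOpen Ω) {F : ℂ → A × A} (hF : IsStem (sliceDom Ω) F) (hi : Induces Ω F f)
    (hd : DifferentiableOn ℂ (fun z => toCoord (F z)) (sliceDom Ω)) : IsSliceRegular Ω f := by
  have hD := ho.isOpen_sliceDom
  have h1 : ContDiffOn ℝ 1 F (sliceDom Ω) := by
    have h2 : ContDiffOn ℂ 1 (fun z => toCoord (F z)) (sliceDom Ω) := hd.contDiffOn hD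
    have h3 := h2.restrict_scalars ℝ
    have h4 := (toCoord (A := A)).symm.contDiff.comp_contDiffOn h3
    refine h4.congr fun z _ => ?_
    simp
  refine ⟨hne, ho, F, hF, hi, h1, fun z hz => ?_⟩
  refine (dbar_eq_zero_iff ?_).2 (hd.differentiableAt (hD.mem_nhds hz))
  exact (h1.differentiableOn one_ne_zero).differentiableAt (hD.mem_nhds hz)

end ComplexCoordinates

/-! ### Terms of the expansions, and the shapes of the shells. -/

section Terms

variable {A : Type*} [NormedStarAlg A] [IsSliceAlg A]

theorem ind_pt {F : ℂ → A × A} (hF : IsStem Set.univ F) {J : A} (hJ : J ∈ imagUnits A) (z : ℂ) :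
    ind F (pt J z) = ev J (F z) :=
  induces_ind (Ω := circ Set.univ) (hF.mono (Set.subset_univ _)) z
    (mem_sliceDom_circ.2 (Or.inl trivial)) J hJ

theorem isStem_cpow {F : ℂ → A × A} (hF : IsStem Set.univ F) (n : ℕ) :
    IsStem Set.univ (fun z => cpow (F z) n) := by
  induction n with
  | zero => exact isStem_const_real _ 1
  | succ n ih => exact hF.cmul ih

theorem isStem_binomStem (y : A) : IsStem Set.univ (binomStem y) := by
  intro z _
  simp [binomStem, cconj]

theorem deltaStem_conj (y : A) (z : ℂ) : deltaStem y (conj z) = conj (deltaStem y z) := by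
  rw [deltaStem, deltaStem, map_add, map_sub, map_pow, map_mul, Complex.conj_ofReal,
    Complex.conj_ofReal]

theorem isStem_binomZPowStem (y : A) (n : ℤ) : IsStem Set.univ (binomZPowStem y n) := by
  match n with
  | Int.ofNat k => exact isStem_cpow (isStem_binomStem y) k
  | Int.negSucc k =>
    refine isStem_cpow (F := binomInvStem y) ?_ (k + 1)
    exact IsStem.csmul (fun z _ => by rw [deltaStem_conj, map_inv₀]) (isStem_binomStem (star y))

theorem deltaStem_pt {J : A} (hJ : J ∈ imagUnits A) (z₀ z : ℂ) :
    deltaStem (pt J z₀) z = (z - z₀) * (z - conj z₀) := by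
  rw [deltaStem, reR_pt hJ, norm_pt hJ, ← Complex.normSq_eq_norm_sq, ← Complex.mul_conj]
  have : ((2 * z₀.re : ℝ) : ℂ) = z₀ + conj z₀ := by
    rw [Complex.add_conj]
  rw [this]; ring

theorem binomStem_pt {J : A} (z₀ z : ℂ) :
    binomStem (pt J z₀) z = (pt J ((z.re : ℂ) - z₀), pt J (z.im : ℂ)) := by
  rw [binomStem, pt_sub, pt_ofReal, pt_ofReal]

theorem exists_cpow_pt {J : A} (hJ : J ∈ imagUnits A) (u v : ℂ) (k : ℕ) :
    ∃ u' v' : ℂ, cpow (pt J u, pt J v) k = (pt J u', pt J v') ∧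
      u' + Complex.I * v' = (u + Complex.I * v) ^ k := by
  induction k with
  | zero => exact ⟨1, 0, by rw [cpow, pt_one, pt_zero], by simp⟩
  | succ k ih =>
    obtain ⟨u', v', h1, h2⟩ := ih
    refine ⟨u * u' - v * v', u * v' + v * u', ?_, ?_⟩
    · rw [cpow, h1, cmul, pt_mul hJ, pt_mul hJ, pt_mul hJ, pt_mul hJ, pt_sub]
      ext
      · rfl
      · simp only [pt, Complex.add_re, Complex.add_im]; module
    · rw [pow_succ, ← h2]
      linear_combination -(v * v') * Complex.I_sq

theorem ev_cpow_cmul {J : A} (hJ : J ∈ imagUnits A) (u v : ℂ) (k : ℕ) (q : A × A) :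
    ev J (cmul (cpow (pt J u, pt J v) k) q) = pt J ((u + Complex.I * v) ^ k) * ev J q := by
  obtain ⟨u', v', h1, h2⟩ := exists_cpow_pt hJ u v k
  rw [h1, ev_cmul_pt hJ, h2]

theorem csmul_pt_pt {J : A} (u v w : ℂ) : csmul w (pt J u, pt J v) =
    (pt J (w.re * u - w.im * v), pt J (w.re * v + w.im * u)) := by
  ext <;> simp only [csmul, pt, Complex.sub_re, Complex.sub_im, Complex.add_re, Complex.add_im,
    Complex.re_ofReal_mul, Complex.im_ofReal_mul] <;> module

/-- When the centre lies in `ℂ_J`, the stem function of `x - y` has its components in `ℂ_J`, where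
`ev J` is multiplicative; so slice powers become ordinary ones. For negative exponents the factor `z
- conj z₀` of `Δ_y` has to cancel, whence the hypothesis on `z`. -/
theorem laurentTerm_pt {J : A} (hJ : J ∈ imagUnits A) {z₀ z : ℂ} (hz : z ≠ conj z₀) (n : ℤ)
    (a : A) : laurentTerm (pt J z₀) n a (pt J z) = pt J ((z - z₀) ^ n) * a := by
  rw [laurentTerm, ind_pt ((isStem_binomZPowStem _ n).cmul (isStem_const_real _ a)) hJ]
  have ha : ev J (a, (0 : A)) = a := by simp [ev]
  have hzz : (z.re : ℂ) + Complex.I * z.im = z := by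
    rw [mul_comm]; exact Complex.re_add_im z
  match n with
  | Int.ofNat k =>
    change ev J (cmul (cpow (binomStem (pt J z₀) z) k) (a, 0)) = _
    rw [binomStem_pt, ev_cpow_cmul hJ, ha]
    have h1 : (z.re : ℂ) - z₀ + Complex.I * z.im = z - z₀ := by linear_combination hzz
    rw [h1, Int.ofNat_eq_natCast, zpow_natCast]
  | Int.negSucc k =>
    change ev J (cmul (cpow (binomInvStem (pt J z₀) z) (k + 1)) (a, 0)) = _
    rw [binomInvStem, star_pt hJ, binomStem_pt, csmul_pt_pt, ev_cpow_cmul hJ, ha]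
    rw [zpow_negSucc, ← inv_pow]
    set w := (deltaStem (pt J z₀) z)⁻¹ with hw
    have hww : (w.re : ℂ) + Complex.I * w.im = w := by
      rw [mul_comm]; exact Complex.re_add_im w
    have h1 : (w.re : ℂ) * ((z.re : ℂ) - conj z₀) - w.im * z.im +
        Complex.I * (w.re * z.im + w.im * ((z.re : ℂ) - conj z₀)) = w * (z - conj z₀) := by
      linear_combination (z - conj z₀) * hww +
        ((w.re : ℂ) + Complex.I * w.im) * hzz - w.im * z.im * Complex.I_sq
    rw [h1, hw, deltaStem_pt hJ, mul_inv, mul_assoc,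
      inv_mul_cancel₀ (sub_ne_zero.2 hz), mul_one]

theorem isStem_sphericalStem (y : A) (n : ℤ) (c : A) :
    IsStem Set.univ (fun z => csmul (deltaStem y z ^ (n / 2))
      (if Even n then (c, 0) else cmul (binomStem y z) (c, 0))) := by
  refine IsStem.csmul (fun z _ => by rw [deltaStem_conj, map_zpow₀]) ?_
  by_cases h : Even n
  · simp only [h, if_true]; exact isStem_const_real _ c
  · simp only [h, if_false]; exact (isStem_binomStem y).cmul (isStem_const_real _ c)

theorem sphericalTerm_pt {J : A} (hJ : J ∈ imagUnits A) (y : A) (n : ℤ) (c : A) (z : ℂ) :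
    sphericalTerm y n c (pt J z) = ev J (csmul (deltaStem y z ^ (n / 2))
      (if Even n then (c, 0) else cmul (binomStem y z) (c, 0))) :=
  ind_pt (isStem_sphericalStem y n c) hJ z

theorem binomStem_cmul (y c : A) (z : ℂ) :
    cmul (binomStem y z) (c, 0) = csmul z (c, 0) - (y * c, 0) := by
  ext <;> simp [cmul, binomStem, csmul, sub_mul, smul_mul_A]

theorem pt_delta_eq {J : A} (hJ : J ∈ imagUnits A) {y : A} (hy : y ∈ quadCone A) (z : ℂ) :
    pt J z * pt J z - pt J z * (y + star y) + y * star y = pt J (deltaStem y z) := by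
  obtain ⟨J', hJ', z₀, rfl⟩ := mem_quadCone_iff.1 hy
  rw [pt_add_star hJ', pt_mul_star hJ', pt_mul hJ, mul_smul_A, mul_one, deltaStem,
    reR_pt hJ', norm_pt hJ', ← pow_two]
  rw [show z * ((2 * z₀.re : ℝ) : ℂ) = ((2 * z₀.re : ℝ) : ℂ) * z by ring]
  simp only [pt, Complex.add_re, Complex.add_im, Complex.sub_re, Complex.sub_im,
    Complex.re_ofReal_mul, Complex.im_ofReal_mul, Complex.ofReal_re, Complex.ofReal_im]
  module

theorem cassini_pt {J : A} (hJ : J ∈ imagUnits A) {y : A} (hy : y ∈ quadCone A) (z : ℂ) :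
    cassini (pt J z) y = Real.sqrt ‖deltaStem y z‖ := by
  rw [cassini, pt_delta_eq hJ hy, norm_pt hJ]

theorem pt_mem_cassiniShell {J : A} (hJ : J ∈ imagUnits A) {y : A} (hy : y ∈ quadCone A) {z : ℂ}
    {r : ℝ} (hr : 0 < r) :
    pt J z ∈ cassiniShell y 0 r ↔ 0 < ‖deltaStem y z‖ ∧ ‖deltaStem y z‖ < r ^ 2 := by
  have h1 : pt J z ∈ cassiniShell y 0 r ↔
      pt J z ∈ quadCone A ∧ 0 < cassini (pt J z) y ∧ cassini (pt J z) y < r := Iff.rfl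
  rw [h1, cassini_pt hJ hy, Real.sqrt_pos, Real.sqrt_lt' hr]
  simp [pt_mem_quadCone hJ z]

theorem pt_mem_cassiniBall {J : A} (hJ : J ∈ imagUnits A) {y : A} (hy : y ∈ quadCone A) {z : ℂ}
    {r : ℝ} (hr : 0 < r) : pt J z ∈ cassiniBall y r ↔ ‖deltaStem y z‖ < r ^ 2 := by
  have h1 : pt J z ∈ cassiniBall y r ↔ pt J z ∈ quadCone A ∧ cassini (pt J z) y < r := Iff.rfl
  rw [h1, cassini_pt hJ hy, Real.sqrt_lt' hr]
  simp [pt_mem_quadCone hJ z]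

theorem deltaStem_eq {y : A} (hy : y ∈ quadCone A) (z : ℂ) :
    deltaStem y z = (z - coord y) * (z - conj (coord y)) := by
  obtain ⟨J, hJ, e⟩ := exists_eq_pt_coord hy
  conv_lhs => rw [e, deltaStem_pt hJ]

theorem pt_mem_sigmaShell {J : A} (hJ : J ∈ imagUnits A) {z₀ z : ℂ} {R : ℝ}
    (h0 : 0 < ‖z - z₀‖) (hR : ‖z - z₀‖ < R) : pt J z ∈ sigmaShell (pt J z₀) 0 R := by
  have hs : SameSlice (pt J z) (pt J z₀) := ⟨J, hJ, ⟨z, rfl⟩, ⟨z₀, rfl⟩⟩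
  refine ⟨pt_mem_quadCone hJ z, ?_, ?_⟩
  · rw [tauDist, if_pos hs, ← pt_sub, norm_pt hJ]; exact h0
  · rw [sigmaDist, if_pos hs, ← pt_sub, norm_pt hJ]; exact hR

/-- For small radii, `Σ(y, 0, R)` is a punctured disc, or a punctured ball if `y` is real. -/
theorem exists_of_mem_sigmaShell {y x : A} (hy : y ∈ quadCone A) {R : ℝ}
    (hR : (coord y).im = 0 ∨ R ≤ (coord y).im) (hx : x ∈ sigmaShell y 0 R) :
    ∃ J ∈ imagUnits A, y = pt J (coord y) ∧ ∃ z, x = pt J z ∧ 0 < ‖z - coord y‖ ∧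
      ‖z - coord y‖ < R := by
  obtain ⟨hxq, h1, h2⟩ := hx
  obtain ⟨Jx, hJx, ex⟩ := exists_eq_pt_coord hxq
  obtain ⟨Jy, hJy, ey⟩ := exists_eq_pt_coord hy
  have hs : SameSlice x y := by
    rcases hR with hR | hR
    · refine ⟨Jx, hJx, ⟨_, ex.symm⟩, ⟨coord y, ?_⟩⟩
      rw [pt_of_im_eq_zero _ hR]
      conv_rhs => rw [ey, pt_of_im_eq_zero _ hR]
    -- Off the planes through `y`, `sigmaDist` is at least `‖imA y‖ = (coord y).im`, hence at least
    -- `R`.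
    · by_contra hs
      rw [sigmaDist, if_neg hs] at h2
      have h3 : (coord y).im ≤ Real.sqrt (‖reA x - reA y‖ ^ 2 + (‖imA x‖ + ‖imA y‖) ^ 2) := by
        refine Real.le_sqrt_of_sq_le ?_
        have : (coord y).im = ‖imA y‖ := rfl
        rw [this]
        nlinarith [sq_nonneg ‖reA x - reA y‖, norm_nonneg (imA x), norm_nonneg (imA y)]
      linarith
  rw [tauDist, if_pos hs] at h1
  rw [sigmaDist, if_pos hs] at h2
  obtain ⟨J, hJ, ⟨z, rfl⟩, ⟨w, hw⟩⟩ := hs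
  have key : ∀ J' ∈ imagUnits A, ∀ z', pt J z = pt J' z' → y = pt J' (coord y) →
      ∃ J ∈ imagUnits A, y = pt J (coord y) ∧ ∃ z₁, pt J' z' = pt J z₁ ∧ 0 < ‖z₁ - coord y‖ ∧
      ‖z₁ - coord y‖ < R := by
    intro J' hJ' z' e e'
    rw [e, e', ← pt_sub, norm_pt hJ'] at h1 h2
    exact ⟨J', hJ', e', z', rfl, h1, h2⟩
  -- `coord y` is in the closed upper half-plane; if `y` sits at the conjugate point for `J`, the
  -- unit is replaced by `-J`.
  rcases coord_pt_eq_or hJ w with h | h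
  · exact key J hJ z rfl (by rw [← hw, h])
  · have e : pt J z = pt (-J) (conj z) := by rw [pt_neg, Complex.conj_conj]
    rw [e]
    exact key (-J) (neg_mem_imagUnits hJ) (conj z) e
      (by rw [← hw, h, pt_neg, Complex.conj_conj])

end Terms

/-! ### Laurent expansions at a point and meromorphy of the stem function. -/

section LaurentSeries

variable {A : Type*} [NormedStarAlg A] [IsSliceAlg A]

theorem stemCoord_eq {Ω : Set A} {f : A → A} (hi : Induces Ω (stem f) f) {J : A}
    (hJ : J ∈ imagUnits A) {z : ℂ} (hz : z ∈ sliceDom Ω) :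
    stemCoord f z = epsCoord J (f (pt J z)) + epsCoord (-J) (f (pt (-J) z)) := by
  rw [hi z hz J hJ, hi z hz (-J) (neg_mem_imagUnits hJ), epsCoord_apply, epsCoord_apply, ← map_add,
    stemCoord]
  exact congrArg toCoord (eps_ev_add hJ (stem f z)).symm

/-- Used to force coefficients into `A`: averaging with the conjugate series keeps only their
`A`-components, and by the stem symmetry it does not change the sum. -/
theorem hasSum_real_part {u : ℕ → ℂ} {v : ℕ → CoordSpace A} {S S' : CoordSpace A}
    (h : HasSum (fun j => u j • v j) S) (h' : HasSum (fun j => conj (u j) • v j) S') :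
    HasSum (fun j => u j • toCoord ((toCoord.symm (v j)).1, (0 : A)))
      ((1 / 2 : ℂ) • (S + star S')) := by
  refine ((h.add h'.star).const_smul (1 / 2 : ℂ)).congr_fun fun j => ?_
  rw [toCoord_real, smul_comm, star_smul]
  simp only [RCLike.star_def, Complex.conj_conj, smul_add]

/-- At a real point `unitIm y` is `0` and `J` is arbitrary, so the two evaluations agree only if the
second component vanishes. -/
theorem ev_unitIm {y : A} {J : A} (hJ : J ∈ imagUnits A)
    (e : y = pt J (coord y)) {p : A × A} (hp : (coord y).im = 0 → p.2 = 0) :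
    ev (unitIm y) p = ev J p := by
  by_cases h : (coord y).im = 0
  · simp [ev, hp h]
  · have h1 : 0 < (coord y).im := lt_of_le_of_ne (coord_im_nonneg y) (Ne.symm h)
    rw [e, unitIm_pt hJ h1]

theorem ne_conj_of_norm_lt {z₀ z : ℂ} {R : ℝ} (hR : z₀.im = 0 ∨ R ≤ |z₀.im|)
    (h0 : 0 < ‖z - z₀‖) (h1 : ‖z - z₀‖ < R) : z ≠ conj z₀ := by
  rintro rfl
  rcases hR with h | h
  · rw [Complex.conj_eq_iff_im.2 h, sub_self, norm_zero] at h0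
    exact lt_irrefl _ h0
  · have h2 : (conj z₀ - z₀) = ((-(2 * z₀.im) : ℝ) : ℂ) * Complex.I := by
      apply Complex.ext <;> simp
      ring
    rw [h2, norm_mul, Complex.norm_I, mul_one, Complex.norm_real, norm_neg, Real.norm_eq_abs,
      abs_mul, abs_two] at h1
    linarith [abs_nonneg z₀.im]

theorem exists_radius (z₀ : ℂ) {R : ℝ} (hR : 0 < R) :
    ∃ R' > 0, R' ≤ R ∧ (z₀.im = 0 ∨ R' ≤ |z₀.im|) := by
  by_cases h : z₀.im = 0
  · exact ⟨R, hR, le_rfl, Or.inl h⟩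
  · exact ⟨min R |z₀.im|, lt_min hR (abs_pos.2 h), min_le_left _ _, Or.inr (min_le_right _ _)⟩

theorem IsLaurentExpansion.hasSum_epsCoord {Ω : Set A} {f : A → A} {J : A} (hJ : J ∈ imagUnits A)
    {z₀ : ℂ} {a : ℤ → A} (h : IsLaurentExpansion Ω f (pt J z₀) a) :
    ∃ R > 0, ∀ z, 0 < ‖z - z₀‖ → ‖z - z₀‖ < R → pt J z ∈ Ω ∧
      HasSum (fun n : ℤ => (z - z₀) ^ n • epsCoord J (a n)) (epsCoord J (f (pt J z))) := by
  obtain ⟨R₁, hR₁, hsub, hsum⟩ := h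
  obtain ⟨R, hR, hle, hR'⟩ := exists_radius z₀ hR₁
  refine ⟨R, hR, fun z h0 h1 => ?_⟩
  have hmem := pt_mem_sigmaShell hJ h0 (h1.trans_le hle)
  refine ⟨hsub hmem, ((hsum _ hmem).mapL (epsCoord J)).congr_fun fun n => ?_⟩
  rw [laurentTerm_pt hJ (ne_conj_of_norm_lt hR' h0 h1), epsCoord_pt_mul hJ]

/-- The expansion at `pt J z₀` sees only the `J`-half of the stem function near `z₀`; the other half
comes from the expansion at `pt (-J) z₀`, the conjugate point of the same sphere. -/
theorem exists_analyticAt_of_isLaurentExpansion {Ω : Set A} {f : A → A}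
    (hi : Induces Ω (stem f) f) {J : A} (hJ : J ∈ imagUnits A) {z₀ : ℂ}
    {a a' : ℤ → A} {k : ℕ} (h : IsLaurentExpansion Ω f (pt J z₀) a)
    (h' : IsLaurentExpansion Ω f (pt (-J) z₀) a') (ha : ∀ n : ℤ, n < -(k : ℤ) → a n = 0)
    (ha' : ∀ n : ℤ, n < -(k : ℤ) → a' n = 0) :
    ∃ P : ℂ → CoordSpace A, AnalyticAt ℂ P z₀ ∧
      ∀ᶠ z in 𝓝[≠] z₀, (z - z₀) ^ k • stemCoord f z = P z := by
  obtain ⟨R, hR, hs⟩ := h.hasSum_epsCoord hJ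
  obtain ⟨R', hR', hs'⟩ := h'.hasSum_epsCoord (neg_mem_imagUnits hJ)
  refine exists_analyticAt_of_hasSum_zpow (R := min R R') (lt_min hR hR')
    (b := fun n => epsCoord J (a n) + epsCoord (-J) (a' n))
    (fun n hn => by simp only [ha n hn, ha' n hn, map_zero, add_zero]) fun z h0 h1 => ?_
  obtain ⟨hz, hsum⟩ := hs z h0 (h1.trans_le (min_le_left _ _))
  obtain ⟨-, hsum'⟩ := hs' z h0 (h1.trans_le (min_le_right _ _))
  rw [stemCoord_eq hi hJ ⟨J, hJ, hz⟩]
  simpa only [smul_add] using hsum.add hsum'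

theorem eventually_nhdsNE_iff {p : ℂ → Prop} {z₀ : ℂ} :
    (∀ᶠ z in 𝓝[≠] z₀, p z) ↔ ∃ R > 0, ∀ z, 0 < ‖z - z₀‖ → ‖z - z₀‖ < R → p z := by
  rw [eventually_nhdsWithin_iff, Metric.eventually_nhds_iff]
  simp only [dist_eq_norm, norm_pos_iff, sub_ne_zero, Set.mem_compl_iff, Set.mem_singleton_iff]
  exact ⟨fun ⟨R, hR, h⟩ => ⟨R, hR, fun z h0 h1 => h h1 h0⟩,
    fun ⟨R, hR, h⟩ => ⟨R, hR, fun z h1 h0 => h z h0 h1⟩⟩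

theorem IsSingularity.eventually_mem {Ω : Set A} {J : A} (hJ : J ∈ imagUnits A) {z₀ : ℂ}
    (h : IsSingularity Ω (pt J z₀)) : ∀ᶠ z in 𝓝[≠] z₀, z ∈ sliceDom Ω := by
  obtain ⟨-, R, hR, hsub⟩ := h
  exact eventually_nhdsNE_iff.2
    ⟨R, hR, fun z h0 h1 => ⟨J, hJ, hsub (pt_mem_sigmaShell hJ h0 h1)⟩⟩

/-- `ℕ∞` is well-ordered, so a finite infimum is attained. -/
theorem exists_isLaurentExpansion_of_ord_lt_top {Ω : Set A} {f : A → A} {y : A}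
    (h : ord Ω f y < ⊤) : ∃ k : ℕ, ord Ω f y = k ∧ ∃ a : ℤ → A, IsLaurentExpansion Ω f y a ∧
      ∀ n : ℤ, n < -(k : ℤ) → a n = 0 := by
  have hne : {m : ℕ∞ | ∃ k : ℕ, m = (k : ℕ∞) ∧ ∃ a : ℤ → A, IsLaurentExpansion Ω f y a ∧
      ∀ n : ℤ, n < -(k : ℤ) → a n = 0}.Nonempty := by
    by_contra hne
    rw [Set.not_nonempty_iff_eq_empty] at hne
    rw [ord, hne, sInf_empty] at h
    exact lt_irrefl _ h
  exact csInf_mem hne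

theorem IsRemovable.meromorphicAt {Ω : Set A} {f : A → A} (hc : IsCircular Ω) {J : A}
    (hJ : J ∈ imagUnits A) {z₀ : ℂ} (h : IsRemovable Ω f (pt J z₀)) :
    MeromorphicAt (stemCoord f) z₀ := by
  have hev := h.1.eventually_mem hJ
  obtain ⟨-, Ω₁, g, -, hy, hg, hfg⟩ := h
  have hz₀ : z₀ ∈ sliceDom Ω₁ := ⟨J, hJ, hy⟩
  have han := hg.differentiableOn.analyticAt (hg.2.1.isOpen_sliceDom.mem_nhds hz₀)
  refine han.meromorphicAt.congr ?_
  filter_upwards [hev] with z hz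
  rw [stemCoord, stemCoord, stem_congr hc hfg hz]

/-- Poles need both conjugate points. One removable singularity is enough, because the extension
lives on a circular set. -/
theorem meromorphicAt_stemCoord {Ω : Set A} {f : A → A} (hc : IsCircular Ω)
    (hi : Induces Ω (stem f) f) {J : A} (hJ : J ∈ imagUnits A) {z₀ : ℂ}
    (h : IsPole Ω f (pt J z₀) ∨ IsRemovable Ω f (pt J z₀))
    (h' : IsPole Ω f (pt (-J) z₀) ∨ IsRemovable Ω f (pt (-J) z₀)) :
    MeromorphicAt (stemCoord f) z₀ := by
  rcases h with h | h
  · rcases h' with h' | h'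
    · obtain ⟨k, -, a, ha, ha0⟩ := exists_isLaurentExpansion_of_ord_lt_top h.2
      obtain ⟨k', -, a', ha', ha0'⟩ := exists_isLaurentExpansion_of_ord_lt_top h'.2
      obtain ⟨P, hP, hev⟩ := exists_analyticAt_of_isLaurentExpansion (k := max k k') hi hJ ha ha'
        (fun n hn => ha0 n (by omega)) (fun n hn => ha0' n (by omega))
      have h1 : MeromorphicAt (fun z => (z - z₀) ^ max k k') z₀ := by fun_prop
      refine (h1.inv.smul hP.meromorphicAt).congr ?_
      filter_upwards [hev, self_mem_nhdsWithin] with z hz hne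
      simp only [Pi.smul_apply', Pi.inv_apply]
      rw [← hz, smul_smul, inv_mul_cancel₀ (pow_ne_zero _ (sub_ne_zero.2 hne)), one_smul]
    · exact h'.meromorphicAt hc (neg_mem_imagUnits hJ)
  · exact h.meromorphicAt hc hJ

/-- A slice function whose stem function has a pole at `coord y` has a pole at `y`. -/
theorem exists_isLaurentExpansion {Ω : Set A} {g : A → A} (hc : IsCircular Ω) {G : ℂ → A × A}
    (hG : IsStem (sliceDom Ω) G) (hi : Induces Ω G g) {y : A} (hy : y ∈ quadCone A)
    (hev : ∀ᶠ z in 𝓝[≠] coord y, z ∈ sliceDom Ω) {P : ℂ → CoordSpace A}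
    (hP : AnalyticAt ℂ P (coord y)) {k : ℕ}
    (hPG : ∀ᶠ z in 𝓝[≠] coord y, (z - coord y) ^ k • toCoord (G z) = P z) :
    IsSingularity Ω y ∧ ∃ a : ℤ → A, IsLaurentExpansion Ω g y a ∧
      ∀ n : ℤ, n < -(k : ℤ) → a n = 0 := by
  obtain ⟨R₁, hR₁, h1⟩ := eventually_nhdsNE_iff.1 (hev.and hPG)
  obtain ⟨R₂, hR₂, v₀, hv₀⟩ := exists_hasSum_of_analyticAt hP
  obtain ⟨R, hR, hle, hR'⟩ := exists_radius (coord y) (lt_min hR₁ hR₂)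
  rw [abs_of_nonneg (coord_im_nonneg y)] at hR'
  -- At a real centre one series serves every `J`, so its coefficients must lie in `A`. There `P`
  -- inherits the stem symmetry `star (P (conj z)) = P z`, and averaging makes the coefficients
  -- real.
  obtain ⟨v, hvreal, hv⟩ : ∃ v : ℕ → CoordSpace A,
      ((coord y).im = 0 → ∀ j, (toCoord.symm (v j)).2 = 0) ∧
      ∀ z, 0 < ‖z - coord y‖ → ‖z - coord y‖ < R →
        HasSum (fun j : ℕ => (z - coord y) ^ j • v j) (P z) := by
    by_cases him : (coord y).im = 0
    · refine ⟨fun j => toCoord ((toCoord.symm (v₀ j)).1, (0 : A)), fun _ j => by simp,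
        fun z h0 hz => ?_⟩
      have hcz : conj (coord y) = coord y := Complex.conj_eq_iff_im.2 him
      have hn : ‖conj z - coord y‖ = ‖z - coord y‖ := by
        rw [← hcz, ← map_sub, Complex.norm_conj, hcz]
      have hzlt := hz.trans_le hle
      have e1 := hv₀ z (hzlt.trans_le (min_le_right _ _))
      have e2 := hv₀ (conj z) (by rw [hn]; exact hzlt.trans_le (min_le_right _ _))
      obtain ⟨hzD, hz1⟩ := h1 z h0 (hzlt.trans_le (min_le_left _ _))
      obtain ⟨-, hz2⟩ := h1 (conj z) (by rwa [hn]) (by rw [hn]; exact hzlt.trans_le (min_le_left _ _))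
      have hsub : conj z - coord y = conj (z - coord y) := by rw [map_sub, hcz]
      have hstar : star (P (conj z)) = P z := by
        rw [← hz1, ← hz2, hG z hzD, toCoord_cconj, star_smul, star_star, hsub]
        simp
      have e3 := hasSum_real_part e1 (S' := P (conj z)) (by
        refine e2.congr_fun fun j => ?_
        rw [hsub, map_pow])
      rw [hstar] at e3
      convert e3 using 1
      module
    · exact ⟨v₀, fun h => absurd h him,
        fun z _ hz => hv₀ z ((hz.trans_le hle).trans_le (min_le_right _ _))⟩
  have hshell : sigmaShell y 0 R ⊆ Ω := by
    intro x hx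
    obtain ⟨J, hJ, -, z, rfl, h0, hz⟩ := exists_of_mem_sigmaShell hy hR' hx
    exact (hc.pt_mem_iff hJ).2 (h1 z h0 ((hz.trans_le hle).trans_le (min_le_left _ _))).1
  -- The coefficients are the images under `ev J` of those of `P`, shifted by `k` because `P` is `(z
  -- - z₀)^k` times the stem function.
  refine ⟨⟨hy, R, hR, hshell⟩,
    fun n => if n < -(k : ℤ) then 0 else ev (unitIm y) (toCoord.symm (v (n + k).toNat)),
    ⟨R, hR, hshell, fun x hx => ?_⟩, fun n hn => if_pos hn⟩
  obtain ⟨J, hJ, e, z, rfl, h0, hz⟩ := exists_of_mem_sigmaShell hy hR' hx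
  have hne : z - coord y ≠ 0 := norm_pos_iff.1 h0
  obtain ⟨hzD, hzP⟩ := h1 z h0 ((hz.trans_le hle).trans_le (min_le_left _ _))
  have hterm : ∀ (n : ℤ) (a : A), laurentTerm y n a (pt J z) = pt J ((z - coord y) ^ n) * a := by
    intro n a
    have h3 := ne_conj_of_norm_lt
      (by rwa [abs_of_nonneg (coord_im_nonneg y)]) h0 hz
    conv_lhs => rw [e]
    exact laurentTerm_pt hJ h3 n a
  simp only [hterm]
  refine (hasSum_int_iff_of_eq_zero (k := k) fun n hn => by rw [if_pos hn, mul_zero]).2 ?_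
  have hsum := (((hv z h0 hz).const_smul (((z - coord y) ^ k)⁻¹)).mapL (evCoord J))
  rw [← hzP, smul_smul, inv_mul_cancel₀ (pow_ne_zero k hne), one_smul, evCoord_toCoord] at hsum
  rw [hi z hzD J hJ]
  refine hsum.congr_fun fun j => ?_
  have hj : ¬ ((j : ℤ) - k < -(k : ℤ)) := by omega
  have hj' : ((j : ℤ) - k + k).toNat = j := by omega
  rw [if_neg hj, hj', smul_smul, evCoord_smul hJ, evCoord_apply,
    ev_unitIm hJ e (fun him => hvreal him j), zpow_sub₀ hne, zpow_natCast,
    zpow_natCast, div_eq_inv_mul]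

theorem ord_le_of_isLaurentExpansion {Ω : Set A} {g : A → A} {y : A} {k : ℕ} {a : ℤ → A}
    (h : IsLaurentExpansion Ω g y a) (ha : ∀ n : ℤ, n < -(k : ℤ) → a n = 0) :
    ord Ω g y ≤ k :=
  sInf_le ⟨k, rfl, a, h, ha⟩

/-- A slice function whose stem function is meromorphic at `coord y` has at most a pole at `y`. -/
theorem isPole_of_meromorphicAt {Ω : Set A} {g : A → A} (hc : IsCircular Ω) {G : ℂ → A × A}
    (hG : IsStem (sliceDom Ω) G) (hi : Induces Ω G g) {y : A} (hy : y ∈ quadCone A)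
    (hev : ∀ᶠ z in 𝓝[≠] coord y, z ∈ sliceDom Ω)
    (hm : MeromorphicAt (fun z => toCoord (G z)) (coord y)) : IsPole Ω g y := by
  obtain ⟨k, hk⟩ := hm
  obtain ⟨hs, a, ha, ha0⟩ := exists_isLaurentExpansion hc hG hi hy hev hk
    (Eventually.of_forall fun z => rfl)
  exact ⟨hs, (ord_le_of_isLaurentExpansion ha ha0).trans_lt (WithTop.coe_lt_top k)⟩

end LaurentSeries

/-! ### Spherical expansions and analyticity at a conjugate pair. -/

section SphericalSeries

variable {A : Type*} [NormedStarAlg A] [IsSliceAlg A]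

theorem continuous_deltaStem (y : A) : Continuous (deltaStem y) := by
  unfold deltaStem
  fun_prop

theorem analyticAt_deltaStem (y : A) (z : ℂ) : AnalyticAt ℂ (deltaStem y) z := by
  unfold deltaStem
  fun_prop

theorem deltaStem_eq_zero_iff {y : A} (hy : y ∈ quadCone A) {z : ℂ} :
    deltaStem y z = 0 ↔ z = coord y ∨ z = conj (coord y) := by
  rw [deltaStem_eq hy, mul_eq_zero, sub_eq_zero, sub_eq_zero]

theorem eventually_cassini {y : A} (hy : y ∈ quadCone A) {w : ℂ}
    (hw : w = coord y ∨ w = conj (coord y)) {r : ℝ} (hr : 0 < r) :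
    ∀ᶠ z in 𝓝[≠] w, 0 < ‖deltaStem y z‖ ∧ ‖deltaStem y z‖ < r := by
  have h1 : ∀ᶠ z in 𝓝[≠] w, ‖deltaStem y z‖ < r := by
    refine eventually_nhdsWithin_of_eventually_nhds ?_
    have h2 : ‖deltaStem y w‖ < r := by rwa [(deltaStem_eq_zero_iff hy).2 hw, norm_zero]
    exact (continuous_deltaStem y).norm.continuousAt.eventually_lt continuousAt_const h2
  have h3 : ∀ᶠ z in 𝓝[≠] w, z ≠ coord y ∧ z ≠ conj (coord y) := by
    have h4 : ∀ c : ℂ, ∀ᶠ z in 𝓝[≠] w, z ≠ c := by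
      intro c
      by_cases h : w = c
      · subst h; exact self_mem_nhdsWithin
      · exact eventually_nhdsWithin_of_eventually_nhds (eventually_ne_nhds h)
    exact (h4 _).and (h4 _)
  filter_upwards [h1, h3] with z hz1 hz2
  refine ⟨norm_pos_iff.2 fun h => ?_, hz1⟩
  rcases (deltaStem_eq_zero_iff hy).1 h with h | h
  · exact hz2.1 h
  · exact hz2.2 h

/-- `|Δ_y(z)|` is the product of the distances to the two roots; if it is below `R R'`, one of the
distances is below its radius. -/
theorem exists_cassini_radius {y : A} (hy : y ∈ quadCone A) {p : ℂ → Prop}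
    (h : ∀ᶠ z in 𝓝[≠] coord y, p z) (h' : ∀ᶠ z in 𝓝[≠] conj (coord y), p z) :
    ∃ r > 0, ∀ z, 0 < ‖deltaStem y z‖ → ‖deltaStem y z‖ < r → p z := by
  obtain ⟨R, hR, h⟩ := eventually_nhdsNE_iff.1 h
  obtain ⟨R', hR', h'⟩ := eventually_nhdsNE_iff.1 h'
  refine ⟨R * R', mul_pos hR hR', fun z h0 h1 => ?_⟩
  rw [deltaStem_eq hy, norm_mul] at h0 h1
  have h2 : 0 < ‖z - coord y‖ := pos_of_mul_pos_left h0 (norm_nonneg _)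
  have h3 : 0 < ‖z - conj (coord y)‖ := pos_of_mul_pos_right h0 (norm_nonneg _)
  by_cases h4 : ‖z - coord y‖ < R
  · exact h z h2 h4
  · refine h' z h3 ?_
    by_contra h5
    rw [not_lt] at h4 h5
    exact absurd (mul_le_mul h4 h5 hR'.le (norm_nonneg _)) (not_le.2 h1)

/-- The left multiplication by `y`, in coordinates. -/
abbrev leftCoord (y : A) : CoordSpace A →L[ℂ] CoordSpace A := mulCoord (toCoord (y, 0))

theorem leftCoord_real (y c : A) : leftCoord y (toCoord (c, 0)) = toCoord (y * c, 0) := by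
  rw [leftCoord, mulCoord_toCoord]
  congr 1
  ext <;> simp [cmul]

theorem toCoord_binomStem_cmul (y c : A) (z : ℂ) :
    toCoord (cmul (binomStem y z) (c, 0)) =
      z • toCoord (c, (0 : A)) - leftCoord y (toCoord (c, 0)) := by
  rw [binomStem_cmul, map_sub, toCoord_csmul, leftCoord_real]

/-- The stem function of `S_{y,n} · c`. -/
def sphericalStem (y : A) (n : ℤ) (c : A) (z : ℂ) : A × A :=
  csmul (deltaStem y z ^ (n / 2)) (if Even n then (c, 0) else cmul (binomStem y z) (c, 0))

theorem toCoord_sphericalStem_even (y : A) (i : ℤ) (c : A) (z : ℂ) :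
    toCoord (sphericalStem y (2 * i) c z) = deltaStem y z ^ i • toCoord (c, (0 : A)) := by
  have h : (2 * i) / 2 = i := by omega
  rw [sphericalStem, toCoord_csmul, if_pos (even_two_mul i), h]

theorem toCoord_sphericalStem_odd (y : A) (i : ℤ) (c : A) (z : ℂ) :
    toCoord (sphericalStem y (2 * i + 1) c z) = deltaStem y z ^ i •
      (z • toCoord (c, (0 : A)) - leftCoord y (toCoord (c, 0))) := by
  have h : (2 * i + 1) / 2 = i := by omega
  have h' : ¬ Even (2 * i + 1) := by simp
  rw [sphericalStem, toCoord_csmul, if_neg h', h, toCoord_binomStem_cmul]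

theorem toCoord_sphericalStem_zero (y : A) (n : ℤ) (z : ℂ) :
    toCoord (sphericalStem y n 0 z) = 0 := by
  rw [← map_zero (toCoord (A := A))]
  congr 1
  simp [sphericalStem, csmul, cmul]

theorem IsSphericalExpansion.hasSum_toCoord {Ω : Set A} {f : A → A} (hi : Induces Ω (stem f) f)
    {y : A} (hy : y ∈ quadCone A) {c : ℤ → A} (h : IsSphericalExpansion Ω f y c) :
    ∃ r > 0, ∀ z, 0 < ‖deltaStem y z‖ → ‖deltaStem y z‖ < r → z ∈ sliceDom Ω ∧
      HasSum (fun n : ℤ => toCoord (sphericalStem y n (c n) z)) (stemCoord f z) := by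
  obtain ⟨r, hr, hsub, hsum⟩ := h
  refine ⟨r ^ 2, pow_pos hr 2, fun z h0 h1 => ?_⟩
  have hJ := someUnit_mem (A := A)
  have hJ' := neg_mem_imagUnits hJ
  have hm := (pt_mem_cassiniShell hJ hy hr).2 ⟨h0, h1⟩
  have hm' := (pt_mem_cassiniShell hJ' hy hr).2 ⟨h0, h1⟩
  have hz : z ∈ sliceDom Ω := ⟨_, hJ, hsub hm⟩
  refine ⟨hz, ?_⟩
  rw [stemCoord_eq hi hJ hz]
  refine (((hsum _ hm).mapL (epsCoord (someUnit A))).add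
    ((hsum _ hm').mapL (epsCoord (-someUnit A)))).congr_fun fun n => ?_
  rw [sphericalTerm_pt hJ, sphericalTerm_pt hJ', epsCoord_apply, epsCoord_apply, ← map_add,
    eps_ev_add hJ]
  rfl

theorem summable_norm_pow_smul {E : Type*} [NormedAddCommGroup E] [NormedSpace ℂ E]
    [CompleteSpace E] {ρ C : ℝ} {v : ℕ → E} (hv : ∀ j, ρ ^ j * ‖v j‖ ≤ C) {w : ℂ}
    (hw : ‖w‖ ≤ ρ / 2) : Summable (fun j => w ^ j • v j) :=
  Summable.of_norm_bounded (summable_geometric_two.mul_left C)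
    (norm_pow_smul_le_geometric hv hw)

/-- The sum of a spherical Laurent series with finite principal part is `Δ_y^{-k}` times a function
analytic at both points of the coordinate plane which correspond to the sphere of `y`. -/
theorem exists_analyticAt_of_isSphericalExpansion {Ω : Set A} {f : A → A}
    (hi : Induces Ω (stem f) f) {y : A} (hy : y ∈ quadCone A) (him : (coord y).im ≠ 0)
    {c : ℤ → A} {k : ℕ} (h : IsSphericalExpansion Ω f y c)
    (hc : ∀ n : ℤ, n < -((2 * k : ℕ) : ℤ) → c n = 0) :
    ∃ P : ℂ → CoordSpace A, AnalyticAt ℂ P (coord y) ∧ AnalyticAt ℂ P (conj (coord y)) ∧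
      ∃ r > 0, ∀ z, 0 < ‖deltaStem y z‖ → ‖deltaStem y z‖ < r → z ∈ sliceDom Ω ∧
        deltaStem y z ^ k • stemCoord f z = P z := by
  obtain ⟨r, hr, hs⟩ := h.hasSum_toCoord hi hy
  set α : ℕ → CoordSpace A := fun i => toCoord (c (2 * ((i : ℤ) - k)), 0) with hα
  set β : ℕ → CoordSpace A := fun i => toCoord (c (2 * ((i : ℤ) - k) + 1), 0) with hβ
  have key : ∀ z, 0 < ‖deltaStem y z‖ → ‖deltaStem y z‖ < r →
      Summable (fun i : ℕ => deltaStem y z ^ i • α i) ∧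
      Summable (fun i : ℕ => deltaStem y z ^ i • (z • β i - leftCoord y (β i))) ∧
      deltaStem y z ^ k • stemCoord f z = (∑' i : ℕ, deltaStem y z ^ i • α i) +
        ∑' i : ℕ, deltaStem y z ^ i • (z • β i - leftCoord y (β i)) := by
    intro z h0 h1
    have hne : deltaStem y z ≠ 0 := norm_pos_iff.1 h0
    have h2 := (hasSum_int_iff_of_eq_zero (k := 2 * k) fun n hn => by
      rw [hc n hn, toCoord_sphericalStem_zero]).1 (hs z h0 h1).2
    have h3 := h2.const_smul (deltaStem y z ^ k)
    have he : ∀ i : ℕ, deltaStem y z ^ k • toCoord (sphericalStem y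
        (((2 * i : ℕ) : ℤ) - (2 * k : ℕ)) (c (((2 * i : ℕ) : ℤ) - (2 * k : ℕ))) z) =
        deltaStem y z ^ i • α i := by
      intro i
      have e : ((2 * i : ℕ) : ℤ) - (2 * k : ℕ) = 2 * ((i : ℤ) - k) := by push_cast; ring
      rw [e, toCoord_sphericalStem_even, smul_smul, ← zpow_natCast _ k, ← zpow_add₀ hne,
        add_sub_cancel, zpow_natCast]
    have ho : ∀ i : ℕ, deltaStem y z ^ k • toCoord (sphericalStem y
        (((2 * i + 1 : ℕ) : ℤ) - (2 * k : ℕ)) (c (((2 * i + 1 : ℕ) : ℤ) - (2 * k : ℕ))) z) =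
        deltaStem y z ^ i • (z • β i - leftCoord y (β i)) := by
      intro i
      have e : ((2 * i + 1 : ℕ) : ℤ) - (2 * k : ℕ) = 2 * ((i : ℤ) - k) + 1 := by push_cast; ring
      rw [e, toCoord_sphericalStem_odd, smul_smul, ← zpow_natCast _ k, ← zpow_add₀ hne,
        add_sub_cancel, zpow_natCast]
    -- Unconditional summability passes to the even and the odd subseries.
    have se := (h3.summable.comp_injective (i := fun i : ℕ => 2 * i)
      fun i j hij => by simpa using hij).congr he
    have so := (h3.summable.comp_injective (i := fun i : ℕ => 2 * i + 1)
      fun i j hij => by simpa using hij).congr ho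
    refine ⟨se, so, h3.unique (HasSum.even_add_odd ?_ ?_)⟩
    · exact se.hasSum.congr_fun he
    · exact so.hasSum.congr_fun ho
  set a : ℂ := ((coord y).re : ℂ) with ha
  have hane : coord y ≠ a := fun h => him (by rw [h, ha, Complex.ofReal_im])
  obtain ⟨z₁, ⟨hz₁, hz₁r⟩, hz₁a⟩ := ((eventually_cassini hy (Or.inl rfl) hr).and
    (eventually_nhdsWithin_of_eventually_nhds (eventually_ne_nhds hane))).exists
  -- The reflection `z ↦ 2a - z` preserves `Δ_y`. Subtracting the odd series at the two points
  -- removes the term with `y` and leaves `2 (z₁ - a) ∑ Δ^i β_i`, so the `β_i` can be bounded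
  -- separately.
  have hrefl : deltaStem y (2 * a - z₁) = deltaStem y z₁ := by
    have h2 : conj (coord y) = 2 * a - coord y := by
      apply Complex.ext <;> simp [ha]
      ring
    rw [deltaStem_eq hy, deltaStem_eq hy, h2]
    ring
  have sβ : Summable (fun i : ℕ => deltaStem y z₁ ^ i • β i) := by
    have h2 := (key z₁ hz₁ hz₁r).2.1
    have h3 := (key (2 * a - z₁) (by rwa [hrefl]) (by rwa [hrefl])).2.1
    rw [hrefl] at h3
    have h4 := (h2.sub h3).const_smul (2 * (z₁ - a))⁻¹
    refine h4.congr fun i => ?_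
    have h5 : (2 * (z₁ - a)) ≠ 0 := mul_ne_zero two_ne_zero (sub_ne_zero.2 hz₁a)
    rw [← smul_sub, sub_sub_sub_cancel_right, ← sub_smul, smul_comm, smul_smul (2 * (z₁ - a))⁻¹]
    have h6 : (2 * (z₁ - a))⁻¹ * (z₁ - (2 * a - z₁)) = 1 := by
      rw [← inv_mul_cancel₀ h5]; ring
    rw [h6, one_smul]
  obtain ⟨C, hC⟩ := exists_bound_of_summable (key z₁ hz₁ hz₁r).1
  obtain ⟨C', hC'⟩ := exists_bound_of_summable sβ
  simp only [norm_smul, norm_pow] at hC hC'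
  set ρ : ℝ := ‖deltaStem y z₁‖ with hρ
  set B₁ : ℂ → CoordSpace A := fun w => ∑' i : ℕ, w ^ i • α i with hB₁
  set B₂ : ℂ → CoordSpace A := fun w => ∑' i : ℕ, w ^ i • β i with hB₂
  have hd₁ : AnalyticAt ℂ B₁ 0 :=
    (differentiableOn_tsum_pow hC).analyticAt (Metric.ball_mem_nhds _ (by positivity))
  have hd₂ : AnalyticAt ℂ B₂ 0 :=
    (differentiableOn_tsum_pow hC').analyticAt (Metric.ball_mem_nhds _ (by positivity))
  have han : ∀ w, w = coord y ∨ w = conj (coord y) → AnalyticAt ℂ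
      (fun z => B₁ (deltaStem y z) + (z • B₂ (deltaStem y z) - leftCoord y (B₂ (deltaStem y z))))
      w := by
    intro w hw
    have hw0 := (deltaStem_eq_zero_iff hy).2 hw
    have e₁ : AnalyticAt ℂ (fun z => B₁ (deltaStem y z)) w :=
      AnalyticAt.fun_comp (g := B₁) (by rwa [hw0]) (analyticAt_deltaStem y w)
    have e₂ : AnalyticAt ℂ (fun z => B₂ (deltaStem y z)) w :=
      AnalyticAt.fun_comp (g := B₂) (by rwa [hw0]) (analyticAt_deltaStem y w)
    exact e₁.add ((analyticAt_id.smul e₂).sub (((leftCoord y).analyticAt _).fun_comp e₂))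
  refine ⟨_, han _ (Or.inl rfl), han _ (Or.inr rfl), min r (ρ / 2),
    lt_min hr (by positivity), fun z h0 h1 => ⟨(hs z h0 (h1.trans_le (min_le_left _ _))).1, ?_⟩⟩
  rw [(key z h0 (h1.trans_le (min_le_left _ _))).2.2]
  have s₂ := (summable_norm_pow_smul hC' (h1.trans_le (min_le_right _ _)).le).hasSum
  congr 1
  refine (((s₂.const_smul z).sub (s₂.mapL (leftCoord y))).congr_fun fun i => ?_).tsum_eq
  rw [map_smul, smul_sub, smul_comm]

/-- A slice function whose stem function is `Δ_y^{-k}` times an analytic function near the two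
points corresponding to the sphere of `y` has a spherical Laurent expansion starting at `-2k`. -/
theorem exists_isSphericalExpansion {Ω : Set A} {g : A → A} (hc : IsCircular Ω) {G : ℂ → A × A}
    (hG : IsStem (sliceDom Ω) G) (hi : Induces Ω G g) {y : A} (hy : y ∈ quadCone A)
    (him : (coord y).im ≠ 0) {H : ℂ → CoordSpace A} (h1 : AnalyticAt ℂ H (coord y))
    (h2 : AnalyticAt ℂ H (conj (coord y))) {k : ℕ} {r₀ : ℝ} (hr₀ : 0 < r₀)
    (hGH : ∀ z, 0 < ‖deltaStem y z‖ → ‖deltaStem y z‖ < r₀ → z ∈ sliceDom Ω ∧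
      deltaStem y z ^ k • toCoord (G z) = H z) :
    ∃ c : ℤ → A, IsSphericalExpansion Ω g y c ∧ ∀ n : ℤ, n < -((2 * k : ℕ) : ℤ) → c n = 0 := by
  obtain ⟨r₁, hr₁, U, V, hUV⟩ := exists_hasSum_cassini him h1 h2
  simp only [← deltaStem_eq hy] at hUV
  set a : ℂ := ((coord y).re : ℂ) with ha
  set r : ℝ := Real.sqrt (min r₀ r₁) with hr
  have hr0 : 0 < r := Real.sqrt_pos.2 (lt_min hr₀ hr₁)
  have hr2 : r ^ 2 = min r₀ r₁ := Real.sq_sqrt (lt_min hr₀ hr₁).le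
  set U' : ℕ → A := fun j => (toCoord.symm (U j)).1 with hU'
  set V' : ℕ → A := fun j => (toCoord.symm (V j)).1 with hV'
  -- The series for `H` at `z` and at `conj z` are averaged; by the stem symmetry the coefficients
  -- can then be taken in `A`.
  have key : ∀ z, 0 < ‖deltaStem y z‖ → ‖deltaStem y z‖ < r ^ 2 → z ∈ sliceDom Ω ∧
      ∃ u v : CoordSpace A,
      HasSum (fun j : ℕ => deltaStem y z ^ j • toCoord (U' j, (0 : A))) u ∧
      HasSum (fun j : ℕ => deltaStem y z ^ j • toCoord (V' j, (0 : A))) v ∧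
      deltaStem y z ^ k • toCoord (G z) = u + (z - a) • v := by
    intro z h0 hz
    rw [hr2] at hz
    have hn : ‖deltaStem y (conj z)‖ = ‖deltaStem y z‖ := by
      rw [deltaStem_conj, Complex.norm_conj]
    obtain ⟨hzD, e1⟩ := hGH z h0 (hz.trans_le (min_le_left _ _))
    obtain ⟨-, e2⟩ := hGH (conj z) (by rwa [hn]) (by rw [hn]; exact hz.trans_le (min_le_left _ _))
    obtain ⟨u, v, hu, hv, e⟩ := hUV z (hz.trans_le (min_le_right _ _))
    obtain ⟨u', v', hu', hv', e'⟩ :=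
      hUV (conj z) (by rw [hn]; exact hz.trans_le (min_le_right _ _))
    simp only [deltaStem_conj, ← map_pow] at hu' hv'
    refine ⟨hzD, _, _, hasSum_real_part hu hu', hasSum_real_part hv hv', ?_⟩
    have e3 : H z = star (H (conj z)) := by
      rw [← e1, ← e2, hG z hzD, toCoord_cconj, star_smul, star_star, deltaStem_conj]
      simp
    have e4 : H z = (1 / 2 : ℂ) • (H z + star (H (conj z))) := by
      rw [← e3]; module
    rw [e1, e4, e, e', star_add, star_smul]
    have e5 : star (conj z - a) = z - a := by
      rw [RCLike.star_def, map_sub, Complex.conj_conj, ha, Complex.conj_ofReal]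
    rw [e5]
    module
  have hshell : cassiniShell y 0 r ⊆ Ω := by
    intro x hx
    obtain ⟨J, hJ, z, rfl⟩ := mem_quadCone_iff.1 hx.1
    obtain ⟨h0, hz⟩ := (pt_mem_cassiniShell hJ hy hr0).1 hx
    exact (hc.pt_mem_iff hJ).2 (key z h0 hz).1
  -- From `(z - a) V_j = (z - y) V_j + (y - a) V_j`: the odd coefficients are the `V_j`, and the
  -- even ones absorb `(y - a) V_j`.
  set c : ℤ → A := fun n => if n < -((2 * k : ℕ) : ℤ) then 0 else
    if Even n then U' (n / 2 + k).toNat + (y * V' (n / 2 + k).toNat -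
      (coord y).re • V' (n / 2 + k).toNat) else V' (n / 2 + k).toNat with hcdef
  have hc0 : ∀ n : ℤ, n < -((2 * k : ℕ) : ℤ) → c n = 0 := fun n hn => if_pos hn
  refine ⟨c, ⟨r, hr0, hshell, fun x hx => ?_⟩, hc0⟩
  obtain ⟨J, hJ, z, rfl⟩ := mem_quadCone_iff.1 hx.1
  obtain ⟨h0, hz⟩ := (pt_mem_cassiniShell hJ hy hr0).1 hx
  obtain ⟨hzD, u, v, hu, hv, e⟩ := key z h0 hz
  have hne : deltaStem y z ≠ 0 := norm_pos_iff.1 h0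
  have hce : ∀ j : ℕ, c (2 * ((j : ℤ) - k)) = U' j + (y * V' j - (coord y).re • V' j) := by
    intro j
    have n1 : ¬ (2 * ((j : ℤ) - k) < -((2 * k : ℕ) : ℤ)) := by push_cast; omega
    have n2 : (2 * ((j : ℤ) - k) / 2 + k).toNat = j := by omega
    simp only [hcdef, if_neg n1, if_pos (even_two_mul ((j : ℤ) - k)), n2]
  have hco : ∀ j : ℕ, c (2 * ((j : ℤ) - k) + 1) = V' j := by
    intro j
    have n1 : ¬ (2 * ((j : ℤ) - k) + 1 < -((2 * k : ℕ) : ℤ)) := by push_cast; omega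
    have n2 : ((2 * ((j : ℤ) - k) + 1) / 2 + k).toNat = j := by omega
    have n3 : ¬ Even (2 * ((j : ℤ) - k) + 1) := by simp
    simp only [hcdef, if_neg n1, if_neg n3, n2]
  have hsum : HasSum (fun n : ℤ => toCoord (sphericalStem y n (c n) z)) (toCoord (G z)) := by
    refine (hasSum_int_iff_of_eq_zero (k := 2 * k) fun n hn => by
      rw [hc0 n hn, toCoord_sphericalStem_zero]).2 ?_
    have hL := hv.mapL (leftCoord y)
    have se := (hu.add (hL.sub (hv.const_smul a))).const_smul ((deltaStem y z ^ k)⁻¹)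
    have so := ((hv.const_smul z).sub hL).const_smul ((deltaStem y z ^ k)⁻¹)
    have etot : toCoord (G z) = (deltaStem y z ^ k)⁻¹ • (u + (leftCoord y v - a • v)) +
        (deltaStem y z ^ k)⁻¹ • (z • v - leftCoord y v) := by
      rw [← smul_add, show u + (leftCoord y v - a • v) + (z • v - leftCoord y v) =
        u + (z - a) • v by module, ← e, smul_smul, inv_mul_cancel₀ (pow_ne_zero _ hne), one_smul]
    rw [etot]
    refine HasSum.even_add_odd (se.congr_fun fun j => ?_) (so.congr_fun fun j => ?_)
    · have e1 : ((2 * j : ℕ) : ℤ) - (2 * k : ℕ) = 2 * ((j : ℤ) - k) := by push_cast; ring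
      have e2 : toCoord (c (2 * ((j : ℤ) - k)), (0 : A)) = toCoord (U' j, (0 : A)) +
          (leftCoord y (toCoord (V' j, 0)) - a • toCoord (V' j, (0 : A))) := by
        rw [hce, leftCoord_real, ← toCoord_csmul, ← map_sub, ← map_add]
        congr 1
        ext <;> simp [csmul, ha]
      rw [e1, toCoord_sphericalStem_even, e2, zpow_sub₀ hne, zpow_natCast, zpow_natCast, map_smul,
        div_eq_inv_mul, mul_smul, smul_add, smul_sub, smul_comm a]
    · have e1 : ((2 * j + 1 : ℕ) : ℤ) - (2 * k : ℕ) = 2 * ((j : ℤ) - k) + 1 := by push_cast; ring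
      rw [e1, toCoord_sphericalStem_odd, hco, zpow_sub₀ hne, zpow_natCast, zpow_natCast, map_smul,
        div_eq_inv_mul, mul_smul, smul_sub, smul_comm z]
  have hev := hsum.mapL (evCoord J)
  rw [evCoord_toCoord] at hev
  rw [hi z hzD J hJ]
  refine hev.congr_fun fun n => ?_
  rw [evCoord_toCoord, sphericalTerm_pt hJ]
  rfl

theorem sphericalOrd_le_of_isSphericalExpansion {Ω : Set A} {g : A → A} {y : A} {k : ℕ}
    {c : ℤ → A} (h : IsSphericalExpansion Ω g y c)
    (hc : ∀ n : ℤ, n < -((2 * k : ℕ) : ℤ) → c n = 0) : sphericalOrd Ω g y ≤ ((2 * k : ℕ) : ℕ∞) :=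
  sInf_le ⟨k, rfl, c, h, hc⟩

end SphericalSeries

/-! ### Regularity and semiregularity of the inverse. -/

section Inverse

variable {A : Type*} [NormedStarAlg A] [IsSliceAlg A]

theorem IsSliceRegular.differentiableOn_normStem {Ω : Set A} {f : A → A} (hr : IsSliceRegular Ω f) :
    DifferentiableOn ℂ (normStem f) (sliceDom Ω) := by
  have hd := hr.differentiableOn
  have h1 : DifferentiableOn ℂ (fun z => mulCoord (stemCoord f z) (cstarCoord (stemCoord f z)))
      (sliceDom Ω) :=
    ((mulCoord (A := A)).differentiable.comp_differentiableOn hd).clm_apply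
      (cstarCoord.differentiable.comp_differentiableOn hd)
  exact ((scalCoord (A := A)).differentiable.comp_differentiableOn h1).congr
    fun z _ => normStem_eq f z

theorem meromorphicAt_clm_comp {E E' : Type*} [NormedAddCommGroup E] [NormedSpace ℂ E]
    [NormedAddCommGroup E'] [NormedSpace ℂ E'] (T : E →L[ℂ] E') {F : ℂ → E} {z₀ : ℂ}
    (h : MeromorphicAt F z₀) : MeromorphicAt (fun z => T (F z)) z₀ := by
  obtain ⟨n, hn⟩ := h
  refine ⟨n, ?_⟩
  have := (T.analyticAt _).fun_comp hn
  simpa only [map_smul] using this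

theorem meromorphicAt_normStem {f : A → A} {z₀ : ℂ} (h : MeromorphicAt (stemCoord f) z₀) :
    MeromorphicAt (normStem f) z₀ := by
  obtain ⟨n, hn⟩ := h
  have h1 : AnalyticAt ℂ (fun z => mulCoord ((z - z₀) ^ n • stemCoord f z)
      (cstarCoord ((z - z₀) ^ n • stemCoord f z))) z₀ := by
    exact ((mulCoord (A := A)).analyticAt_bilinear _).comp₂ hn
      ((cstarCoord.analyticAt _).fun_comp hn)
  -- `ν` is quadratic in the stem function, so the exponent clearing the pole doubles.
  refine ⟨n + n, ?_⟩
  have h2 := ((scalCoord (A := A)).analyticAt _).fun_comp h1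
  refine h2.congr (Eventually.of_forall fun z => ?_)
  simp only [map_smul, FunLike.coe_smul, Pi.smul_apply, normStem_eq, pow_add, smul_eq_mul]
  ring

theorem meromorphicAt_invCoord {f : A → A} {z₀ : ℂ} (h : MeromorphicAt (stemCoord f) z₀) :
    MeromorphicAt (invCoord f) z₀ := by
  have h1 := (meromorphicAt_normStem h).inv.smul (meromorphicAt_clm_comp cstarCoord h)
  refine h1.congr (Eventually.of_forall fun z => ?_)
  rw [invCoord_eq]
  rfl

theorem isSliceRegular_sliceInv {Ω : Set A} {f : A → A} (hr : IsSliceRegular Ω f)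
    (h : IsTame Ω f) (hne : {x ∈ Ω | normalFn f x ≠ 0}.Nonempty) :
    IsSliceRegular {x ∈ Ω | normalFn f x ≠ 0} (sliceInv f) := by
  have hd := IsSliceRegular.differentiableOn_normStem hr
  have ho : IsCircularOpen {x ∈ Ω | normalFn f x ≠ 0} := by
    rw [h.setOf_normalFn_ne_zero]
    refine isCircularOpen_circ ?_ h.conj_mem_ne_zero
    exact hd.continuousOn.isOpen_inter_preimage hr.2.1.isOpen_sliceDom isOpen_ne
  refine isSliceRegular_of_differentiableOn hne ho h.isStem_invStem_ne_zero h.induces_invStem_ne_zero ?_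
  rw [h.sliceDom_ne_zero]
  have h1 : DifferentiableOn ℂ (fun z => (normStem f z)⁻¹ • cstarCoord (stemCoord f z))
      {z ∈ sliceDom Ω | normStem f z ≠ 0} :=
    ((hd.mono fun z hz => hz.1).inv fun z hz => hz.2).smul
      ((cstarCoord.differentiable.comp_differentiableOn hr.differentiableOn).mono
        fun z hz => hz.1)
  exact h1.congr fun z _ => invCoord_eq f z

section Semiregular

variable {Ω Ω' : Set A} {f : A → A}

/-- Both sets are circular, so a sphere not inside `Ω'` misses it entirely and the hypothesis
applies at both conjugate points. -/
theorem IsSemiregular.meromorphicAt (h : IsSemiregular Ω Ω' f) {z₀ : ℂ} (hz : z₀ ∈ sliceDom Ω) :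
    MeromorphicAt (stemCoord f) z₀ ∧ ∀ᶠ z in 𝓝[≠] z₀, z ∈ sliceDom Ω' := by
  obtain ⟨-, hΩ, -, hr, hs⟩ := h
  have hc' := hr.2.1.isCircular
  have ho := hr.2.1.isOpen_sliceDom
  by_cases hz' : z₀ ∈ sliceDom Ω'
  · exact ⟨(hr.differentiableOn.analyticAt (ho.mem_nhds hz')).meromorphicAt,
      eventually_nhdsWithin_of_eventually_nhds (ho.mem_nhds hz')⟩
  · have hJ := someUnit_mem (A := A)
    have hmem : ∀ J ∈ imagUnits A, pt J z₀ ∈ Ω \ Ω' := fun J hJ =>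
      ⟨(hΩ.isCircular.pt_mem_iff hJ).2 hz, fun h => hz' ((hc'.pt_mem_iff hJ).1 h)⟩
    have h1 := hs _ (hmem _ hJ)
    refine ⟨meromorphicAt_stemCoord hc' hr.isSlice.induces_stem hJ h1
      (hs _ (hmem _ (neg_mem_imagUnits hJ))), ?_⟩
    exact (h1.elim (fun h => h.1) fun h => h.1).eventually_mem hJ

/-- Identity theorem for meromorphic functions: on a connected set, finite order at one point
propagates to all points. -/
theorem IsSemiregular.eventually_normStem_ne_zero (h : IsSemiregular Ω Ω' f) (ht : IsTame Ω' f)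
    (hN : NowhereIdenticallyZero Ω Ω' (normalFn f)) {z₀ : ℂ} (hz : z₀ ∈ sliceDom Ω) :
    ∀ᶠ z in 𝓝[≠] z₀, normStem f z ≠ 0 := by
  have hr := h.2.2.2.1
  have hc' := hr.2.1.isCircular
  have ho := hr.2.1.isOpen_sliceDom
  have hm : MeromorphicOn (normStem f) (connectedComponentIn (sliceDom Ω) z₀) := fun z hzc =>
    meromorphicAt_normStem (h.meromorphicAt (connectedComponentIn_subset _ _ hzc)).1
  obtain ⟨x, ⟨hx, w, hw, J, hJ, rfl⟩, hne⟩ := hN z₀ hz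
  have hwD := (hc'.pt_mem_iff hJ).1 hx
  rw [ht.normalFn_pt hJ hwD, Ne, pt_eq_zero_iff hJ] at hne
  have hcont : ContinuousAt (normStem f) w :=
    (IsSliceRegular.differentiableOn_normStem hr).continuousOn.continuousAt (ho.mem_nhds hwD)
  have h1 : meromorphicOrderAt (normStem f) w ≠ ⊤ :=
    (meromorphicOrderAt_ne_top_iff_eventually_ne_zero (hm w hw)).2
      (eventually_nhdsWithin_of_eventually_nhds (hcont.eventually_ne hne))
  have hz₀ := mem_connectedComponentIn hz
  exact (meromorphicOrderAt_ne_top_iff_eventually_ne_zero (hm z₀ hz₀)).1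
    (hm.meromorphicOrderAt_ne_top_of_isPreconnected isPreconnected_connectedComponentIn hw hz₀ h1)

theorem IsSemiregular.eventually_mem_ne_zero (h : IsSemiregular Ω Ω' f) (ht : IsTame Ω' f)
    (hN : NowhereIdenticallyZero Ω Ω' (normalFn f)) {z₀ : ℂ} (hz : z₀ ∈ sliceDom Ω) :
    ∀ᶠ z in 𝓝[≠] z₀, z ∈ sliceDom {x ∈ Ω' | normalFn f x ≠ 0} := by
  rw [ht.sliceDom_ne_zero]
  exact (h.meromorphicAt hz).2.and (h.eventually_normStem_ne_zero ht hN hz)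

theorem IsSemiregular.sliceInv (h : IsSemiregular Ω Ω' f) (ht : IsTame Ω' f)
    (hN : NowhereIdenticallyZero Ω Ω' (normalFn f))
    (hne : {x ∈ Ω' | normalFn f x ≠ 0}.Nonempty) :
    IsSemiregular Ω {x ∈ Ω' | normalFn f x ≠ 0} (sliceInv f) := by
  -- `IsPole` only asks for finite order and so includes order `0`; removable singularities need no
  -- separate treatment.
  refine ⟨h.1, h.2.1, fun x hx => h.2.2.1 hx.1, isSliceRegular_sliceInv h.2.2.2.1 ht hne,
    fun y hy => Or.inl ?_⟩
  have hΩ := h.2.1.isCircular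
  have hq := hΩ.subset_quadCone hy.1
  have hz := (hΩ.coord_mem_iff hq).2 hy.1
  exact isPole_of_meromorphicAt ht.isCircular_ne_zero ht.isStem_invStem_ne_zero ht.induces_invStem_ne_zero hq
    (h.eventually_mem_ne_zero ht hN hz) (meromorphicAt_invCoord (h.meromorphicAt hz).1)

end Semiregular

/-! ### Bounds on the orders of the inverse. -/

section Orders

variable {Ω : Set A} {f : A → A}

/-- A factorization of `N(f)` near the sphere of `y` gives one of its stem function. -/
theorem IsTame.exists_normStem_eq (h : IsTame Ω f) {y : A} (hy : y ∈ quadCone A) {r : ℝ}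
    (hr : 0 < r) (hsub : cassiniShell y 0 r ⊆ Ω) {g : A → A}
    (hg : IsSliceRegular (cassiniBall y r) g) (hgne : ∃ w ∈ sphere y, g w ≠ 0) {δ : ℂ → ℂ}
    (hδc : ∀ z, δ (conj z) = conj (δ z)) (hδ : ∀ z, deltaStem y z ≠ 0 → δ z ≠ 0) {m : ℤ}
    (hfac : ∀ x ∈ cassiniShell y 0 r,
      normalFn f x = ind (fun z => csmul (δ z ^ m) (stem g z)) x) :
    ∃ q : ℂ → ℂ, (∀ w, w = coord y ∨ w = conj (coord y) → AnalyticAt ℂ q w ∧ q w ≠ 0) ∧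
      ∃ r > 0, ∀ z, 0 < ‖deltaStem y z‖ → ‖deltaStem y z‖ < r → normStem f z = δ z ^ m * q z := by
  have hJ := someUnit_mem (A := A)
  have hc : IsCircular Ω := h.1.2.1
  have hgo := hg.2.1.isOpen_sliceDom
  have hgs := hg.isSlice.isStem_stem
  have hF : IsStem (sliceDom (cassiniBall y r)) (fun z => csmul (δ z ^ m) (stem g z)) :=
    IsStem.csmul (fun z _ => by rw [hδc, map_zpow₀]) hgs
  have key : ∀ z, 0 < ‖deltaStem y z‖ → ‖deltaStem y z‖ < r ^ 2 →
      csmul (δ z ^ m) (stem g z) = csmul (normStem f z) (1, 0) := by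
    intro z h0 h1
    have hev : ∀ J ∈ imagUnits A,
        ev J (csmul (δ z ^ m) (stem g z)) = ev J (csmul (normStem f z) (1, 0)) := by
      intro J hJ
      have hm := (pt_mem_cassiniShell hJ hy hr).2 ⟨h0, h1⟩
      have hb := (pt_mem_cassiniBall hJ hy hr).2 h1
      have h2 := hfac _ hm
      rw [h.normalFn_pt hJ ((hc.pt_mem_iff hJ).1 (hsub hm)),
        induces_ind hF z ⟨J, hJ, hb⟩ J hJ] at h2
      rw [ev_csmul_one]
      exact h2.symm
    rw [← eps_ev_add hJ (csmul (δ z ^ m) (stem g z)), hev _ hJ, hev _ (neg_mem_imagUnits hJ),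
      eps_ev_add hJ]
  have hδz : ∀ z, 0 < ‖deltaStem y z‖ → δ z ^ m ≠ 0 := fun z h0 =>
    zpow_ne_zero _ (hδ z (norm_pos_iff.1 h0))
  have hq : ∀ z, 0 < ‖deltaStem y z‖ → ‖deltaStem y z‖ < r ^ 2 →
      normStem f z = δ z ^ m * scal (stem g z) := by
    intro z h0 h1
    rw [← scal_csmul, key z h0 h1, scal_csmul_one]
  -- Off the sphere, `g` is `N(f)` divided by a central scalar, so its stem function is a scalar
  -- multiple of `1`.
  have hreal : ∀ z, 0 < ‖deltaStem y z‖ → ‖deltaStem y z‖ < r ^ 2 →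
      stemCoord g z = scal (stem g z) • toCoord (1, (0 : A)) := by
    intro z h0 h1
    have h2 := congrArg (csmul (δ z ^ m)⁻¹) (key z h0 h1)
    rw [csmul_csmul, csmul_csmul, inv_mul_cancel₀ (hδz z h0), csmul_one, hq z h0 h1,
      inv_mul_cancel_left₀ (hδz z h0)] at h2
    rw [stemCoord, ← toCoord_csmul, ← h2]
  refine ⟨fun z => scal (stem g z), fun w hw => ?_, r ^ 2, pow_pos hr 2, hq⟩
  have hw0 := (deltaStem_eq_zero_iff hy).2 hw
  have hwD : ∀ w, w = coord y ∨ w = conj (coord y) → w ∈ sliceDom (cassiniBall y r) := by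
    intro w hw
    refine ⟨_, hJ, (pt_mem_cassiniBall hJ hy hr).2 ?_⟩
    rw [(deltaStem_eq_zero_iff hy).2 hw, norm_zero]
    exact pow_pos hr 2
  have han := hg.differentiableOn.analyticAt (hgo.mem_nhds (hwD w hw))
  have hqa : AnalyticAt ℂ (fun z => scal (stem g z)) w := by
    refine (((scalCoord (A := A)).analyticAt _).fun_comp han).congr
      (Eventually.of_forall fun z => ?_)
    simp only [stemCoord, scalCoord_toCoord]
  refine ⟨hqa, fun hq0 => ?_⟩
  -- Scalarity passes to the limit at `w`. If the scalar were `0` there, conjugation would make the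
  -- stem function of `g` vanish at `coord y` as well, and `g` would be zero on the whole sphere.
  have hlim : stemCoord g w = scal (stem g w) • toCoord (1, (0 : A)) := by
    refine tendsto_nhds_unique_of_eventuallyEq
      (han.continuousAt.tendsto.mono_left nhdsWithin_le_nhds)
      ((hqa.continuousAt.smul continuousAt_const).tendsto.mono_left
        (nhdsWithin_le_nhds (s := {w}ᶜ))) ?_
    filter_upwards [eventually_cassini hy hw (pow_pos hr 2)] with z hz
    exact hreal z hz.1 hz.2
  beta_reduce at hq0
  rw [hq0, zero_smul, stemCoord, map_eq_zero_iff _ (toCoord (A := A)).injective] at hlim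
  have hlim' : stem g (coord y) = 0 := by
    rcases hw with rfl | rfl
    · exact hlim
    · have h1 := hgs _ (hwD _ (Or.inr rfl))
      rw [Complex.conj_conj, hlim] at h1
      rw [h1]
      simp [cconj]
  obtain ⟨x, ⟨z, hz, J, hJ, rfl⟩, hx⟩ := hgne
  rw [Set.mem_singleton_iff.1 hz] at hx
  refine hx ?_
  rw [hg.isSlice.induces_stem _ (hwD _ (Or.inl rfl)) J hJ, hlim']
  simp

/-- The exponent on the right is `max(m,0) - m = max(-m,0)`, which is nonnegative, so no pole
remains. -/
theorem pow_smul_invCoord {z : ℂ} {δ q : ℂ} (hδ : δ ≠ 0) {m : ℤ} {k : ℕ} {P : CoordSpace A}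
    (hq : normStem f z = δ ^ m * q) (hP : δ ^ k • stemCoord f z = P) :
    δ ^ (m.toNat + k) • invCoord f z = δ ^ (-m).toNat • q⁻¹ • cstarCoord P := by
  rw [invCoord_eq, hq, ← hP, map_smul, smul_smul, smul_smul, smul_smul, mul_inv]
  congr 1
  have h1 : δ ^ m.toNat = δ ^ (-m).toNat * δ ^ m := by
    rw [← zpow_natCast, ← zpow_natCast, ← zpow_add₀ hδ]
    congr 1
    omega
  have h2 : δ ^ m ≠ 0 := zpow_ne_zero _ hδ
  rw [pow_add, h1]
  field_simp

theorem IsTame.sphericalOrd_sliceInv_le (h : IsTame Ω f) {y : A} (hy : y ∈ quadCone A)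
    (him : (coord y).im ≠ 0) :
    sphericalOrd {x ∈ Ω | normalFn f x ≠ 0} (SliceReg.sliceInv f) y ≤
      sphericalMult Ω (normalFn f) y + sphericalOrd Ω f y := by
  -- An empty index set has infimum `⊤`, and the bound is then trivial; otherwise both infima are
  -- attained.
  rcases Set.eq_empty_or_nonempty {k : ℕ∞ | ∃ m : ℤ, HasSphericalFactor Ω (normalFn f) y m ∧
    k = ((2 * m.toNat : ℕ) : ℕ∞)} with h1 | h1
  · rw [sphericalMult, h1, sInf_empty, top_add]; exact le_top
  rcases Set.eq_empty_or_nonempty {m : ℕ∞ | ∃ k : ℕ, m = ((2 * k : ℕ) : ℕ∞) ∧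
    ∃ c : ℤ → A, IsSphericalExpansion Ω f y c ∧ ∀ n : ℤ, n < -((2 * k : ℕ) : ℤ) → c n = 0}
    with h2 | h2
  · rw [sphericalOrd, sphericalOrd, h2, sInf_empty, add_top]; exact le_top
  obtain ⟨m, ⟨r, hr, hsub, g, hg, hgne, hfac⟩, hm⟩ := csInf_mem h1
  obtain ⟨k, hk, c, hexp, hc0⟩ := csInf_mem h2
  have e1 : sphericalMult Ω (normalFn f) y = ((2 * m.toNat : ℕ) : ℕ∞) := hm
  have e2 : sphericalOrd Ω f y = ((2 * k : ℕ) : ℕ∞) := hk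
  obtain ⟨q, hq, r₁, hr₁, hqf⟩ := h.exists_normStem_eq hy hr hsub hg hgne (deltaStem_conj y)
    (fun z hz => hz) hfac
  obtain ⟨P, hP1, hP2, r₂, hr₂, hP⟩ :=
    exists_analyticAt_of_isSphericalExpansion h.1.induces_stem hy him hexp hc0
  have hqne : ∀ w, w = coord y ∨ w = conj (coord y) → ∀ᶠ z in 𝓝[≠] w, q z ≠ 0 := fun w hw =>
    eventually_nhdsWithin_of_eventually_nhds ((hq w hw).1.continuousAt.eventually_ne (hq w hw).2)
  obtain ⟨r₃, hr₃, hq0⟩ := exists_cassini_radius hy (hqne _ (Or.inl rfl)) (hqne _ (Or.inr rfl))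
  have hH : ∀ w, w = coord y ∨ w = conj (coord y) → AnalyticAt ℂ P w → AnalyticAt ℂ
      (fun z => deltaStem y z ^ (-m).toNat • (q z)⁻¹ • cstarCoord (P z)) w := fun w hw hPw =>
    ((analyticAt_deltaStem y w).pow _).smul (((hq w hw).1.inv (hq w hw).2).smul
      ((cstarCoord.analyticAt _).fun_comp hPw))
  obtain ⟨c', hc', hc0'⟩ := exists_isSphericalExpansion (k := m.toNat + k)
    (r₀ := min r₁ (min r₂ r₃)) h.isCircular_ne_zero h.isStem_invStem_ne_zero
    h.induces_invStem_ne_zero hy him (hH _ (Or.inl rfl) hP1) (hH _ (Or.inr rfl) hP2) (by positivity)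
    (fun z h0 hz => by
      have hz1 := hz.trans_le (min_le_left _ _)
      have hz2 := hz.trans_le ((min_le_right _ _).trans (min_le_left _ _))
      have hz3 := hz.trans_le ((min_le_right _ _).trans (min_le_right _ _))
      have hδ : deltaStem y z ≠ 0 := norm_pos_iff.1 h0
      obtain ⟨hzD, hzP⟩ := hP z h0 hz2
      refine ⟨?_, pow_smul_invCoord hδ (hqf z h0 hz1) hzP⟩
      rw [h.sliceDom_ne_zero]
      refine ⟨hzD, ?_⟩
      rw [hqf z h0 hz1]
      exact mul_ne_zero (zpow_ne_zero _ hδ) (hq0 z h0 hz3))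
  refine (sphericalOrd_le_of_isSphericalExpansion hc' hc0').trans (le_of_eq ?_)
  rw [e1, e2, ← Nat.cast_add, mul_add]

theorem IsTame.ord_sliceInv_le (h : IsTame Ω f) {y : A} (hy : y ∈ quadCone A)
    (him : (coord y).im = 0) :
    ord {x ∈ Ω | normalFn f x ≠ 0} (SliceReg.sliceInv f) y ≤
      classicalMult Ω (normalFn f) y + ord Ω f y := by
  rcases Set.eq_empty_or_nonempty {k : ℕ∞ | ∃ n : ℤ, HasRealFactor Ω (normalFn f) y n ∧
    k = ((n.toNat : ℕ) : ℕ∞)} with h1 | h1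
  · rw [classicalMult, h1, sInf_empty, top_add]; exact le_top
  rcases eq_or_ne (ord Ω f y) ⊤ with h2 | h2
  · rw [h2, add_top]; exact le_top
  obtain ⟨m, ⟨r, hr, hsub, g, hg, hgne, hfac⟩, hm⟩ := csInf_mem h1
  obtain ⟨k, hk, a, hexp, ha0⟩ := exists_isLaurentExpansion_of_ord_lt_top (lt_top_iff_ne_top.2 h2)
  have e1 : classicalMult Ω (normalFn f) y = ((m.toNat : ℕ) : ℕ∞) := hm
  obtain ⟨J, hJ, ey⟩ := exists_eq_pt_coord hy
  have hJ' := neg_mem_imagUnits hJ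
  have ey' : y = pt (-J) (coord y) := by
    rw [pt_neg, Complex.conj_eq_iff_im.2 him]; exact ey
  have hre : ((reR y : ℝ) : ℂ) = coord y := Complex.ext (by simp [coord]) (by simp [him])
  obtain ⟨q, hq, r₁, hr₁, hqf⟩ := h.exists_normStem_eq (δ := fun z => z - ((reR y : ℝ) : ℂ))
    hy hr hsub hg ⟨y, ⟨coord y, rfl, J, hJ, ey⟩, hgne⟩
    (fun z => by rw [map_sub, Complex.conj_ofReal])
    (fun z hz hz0 => hz ((deltaStem_eq_zero_iff hy).2 (Or.inl (by
      rw [← hre]; exact sub_eq_zero.1 hz0)))) hfac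
  simp only [hre] at hqf
  -- `y` is real, so it is the same point for `J` and `-J`, and a single expansion supplies both
  -- halves.
  obtain ⟨P, hP, hPf⟩ := exists_analyticAt_of_isLaurentExpansion (z₀ := coord y)
    h.1.induces_stem hJ (by rwa [← ey]) (by rwa [← ey']) ha0 ha0
  obtain ⟨hqa, hqne⟩ := hq _ (Or.inl rfl)
  obtain ⟨R, hR, hRsub⟩ : ∃ R > 0, ∀ z, 0 < ‖z - coord y‖ → ‖z - coord y‖ < R →
      z ∈ sliceDom Ω := by
    obtain ⟨R, hR, hRs, -⟩ := hexp
    refine ⟨R, hR, fun z h0 hz => ⟨J, hJ, hRs ?_⟩⟩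
    have := pt_mem_sigmaShell hJ h0 hz
    rwa [← ey] at this
  have hH : AnalyticAt ℂ
      (fun z => (z - coord y) ^ (-m).toNat • (q z)⁻¹ • cstarCoord (P z)) (coord y) :=
    ((analyticAt_id.sub analyticAt_const).pow _).smul ((hqa.inv hqne).smul ((cstarCoord.analyticAt _).fun_comp hP))
  have hqev : ∀ᶠ z in 𝓝[≠] coord y, normStem f z = (z - coord y) ^ m * q z := by
    filter_upwards [eventually_cassini hy (Or.inl rfl) hr₁] with z hz
    exact hqf z hz.1 hz.2
  have hqne' : ∀ᶠ z in 𝓝[≠] coord y, q z ≠ 0 :=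
    eventually_nhdsWithin_of_eventually_nhds (hqa.continuousAt.eventually_ne hqne)
  have hev : ∀ᶠ z in 𝓝[≠] coord y, z ∈ sliceDom {x ∈ Ω | normalFn f x ≠ 0} := by
    rw [h.sliceDom_ne_zero]
    filter_upwards [eventually_nhdsNE_iff.2 ⟨R, hR, hRsub⟩, hqev, hqne', self_mem_nhdsWithin]
      with z hz1 hz2 hz3 hz4
    refine ⟨hz1, ?_⟩
    rw [hz2]
    exact mul_ne_zero (zpow_ne_zero _ (sub_ne_zero.2 hz4)) hz3
  obtain ⟨-, a', ha', ha0'⟩ := exists_isLaurentExpansion (k := m.toNat + k) h.isCircular_ne_zero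
    h.isStem_invStem_ne_zero h.induces_invStem_ne_zero hy hev hH (by
      filter_upwards [hPf, hqev, self_mem_nhdsWithin] with z hz1 hz2 hz3
      exact pow_smul_invCoord (sub_ne_zero.2 hz3) hz2 hz1)
  refine (ord_le_of_isLaurentExpansion ha' ha0').trans (le_of_eq ?_)
  rw [e1, hk, Nat.cast_add]

end Orders

end Inverse

end SliceReg

end

theorem mainTheorem6 {A : Type*} [NormedStarAlg A] [SliceReg.IsSliceAlg A]
    (Ω Ω' : Set A) (f : A → A)
    (hf : SliceReg.IsSemiregular Ω Ω' f)
    (htame : SliceReg.IsTame Ω' f)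
    (hN : SliceReg.NowhereIdenticallyZero Ω Ω' (SliceReg.normalFn f))
    (Ω'' : Set A) (hΩ'' : Ω'' = {x ∈ Ω' | SliceReg.normalFn f x ≠ 0}) :
    (SliceReg.IsSlice Ω'' (SliceReg.sliceInv f) ∧
      ∀ x ∈ Ω'', SliceReg.sliceMul f (SliceReg.sliceInv f) x = 1 ∧
        SliceReg.sliceMul (SliceReg.sliceInv f) f x = 1) ∧
    SliceReg.IsSemiregular Ω Ω'' (SliceReg.sliceInv f) ∧
    SliceReg.IsTame Ω'' (SliceReg.sliceInv f) ∧
    (∀ y ∈ Ω, y ∉ Set.range (fun r : ℝ => r • (1 : A)) →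
      SliceReg.sphericalOrd Ω'' (SliceReg.sliceInv f) y ≤
        SliceReg.sphericalMult Ω' (SliceReg.normalFn f) y + SliceReg.sphericalOrd Ω' f y) ∧
    (∀ y ∈ Ω, y ∈ Set.range (fun r : ℝ => r • (1 : A)) →
      SliceReg.ord Ω'' (SliceReg.sliceInv f) y ≤
        SliceReg.classicalMult Ω' (SliceReg.normalFn f) y + SliceReg.ord Ω' f y) := by
  subst hΩ''
  have hΩ := hf.2.1.isCircular
  have hne : {x ∈ Ω' | SliceReg.normalFn f x ≠ 0}.Nonempty := by
    obtain ⟨z, hz⟩ := hΩ.nonempty_sliceDom hf.1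
    obtain ⟨x, hx, hx0⟩ := hN z hz
    exact ⟨x, hx.1, hx0⟩
  refine ⟨⟨htame.isSlice_sliceInv hne, fun x hx => htame.sliceMul_sliceInv hx⟩,
    hf.sliceInv htame hN hne, htame.isTame_sliceInv hne, fun y hy hyr => ?_, fun y hy hyr => ?_⟩
  · have hq := hΩ.subset_quadCone hy
    exact htame.sphericalOrd_sliceInv_le hq fun h => hyr ((SliceReg.coord_im_eq_zero_iff hq).1 h)
  · have hq := hΩ.subset_quadCone hy
    exact htame.ord_sliceInv_le hq ((SliceReg.coord_im_eq_zero_iff hq).2 hyr)
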